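/- Let $\phi$ be a real-valued function that is $C^\infty$ in a neighbourhood of the origin of $\mathbb{R}^2$. For a smooth function $f$ near the origin let $\mathcal T(f)$ be the set of $\alpha\in\mathbb{Z}_+^2\setminus\{(0,0)\}$ with $\partial_1^{\alpha_1}\partial_2^{\alpha_2}f(0,0)\neq0$, let the Newton polyhedron $\mathcal N(f)$ be the convex hull of $\bigcup_{\alpha\in\mathcal T(f)}(\alpha+\mathbb{R}_+^2)$, and let the Newton distance $d(f)\in(0,\infty]$ be the number $d$ for which the line $t_1=t_2$ meets the boundary of $\mathcal N(f)$ at $(d,d)$ ($d(f)=\infty$ if $\mathcal N(f)=\emptyset$). The height is $h(f)=\sup_\Psi d(f\circ\Psi)$ over all smooth local diffeomorphisms $\Psi$ at the origin with $\Psi(0)=0$, and the linear height is $h_{lin}(f)=\sup_{L\in GL(\mathbb{R}^2)}d(f\circ L)$. For $m\in\mathbb{N}$ and $n\in\mathbb{N}\cup\{\infty\}$ say that $\phi$ satisfies $(D_{m,n})$ if there are an invertible linear map $L$ of $\mathbb{R}^2$ and functions $b(x_1,x_2)$, $\omega(x_1)$, $b_0(x_1)$, smooth near the origin, such that in a neighbourhood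 of the origin $$\phi(L(x_1,x_2))=b(x_1,x_2)\,(x_2-x_1^m\omega(x_1))^2+b_0(x_1),$$ where $b(0,0)=0$, $\partial_1b(0,0)\neq0$, $\partial_2b(0,0)=0$, $m\ge2$, $\omega(0)\neq0$, $2m+1<n$, and either $n<\infty$ and $b_0(x_1)=x_1^n\beta(x_1)$ near $0$ with $\beta$ smooth and $\beta(0)\neq0$, or $n=\infty$ and $b_0$ is flat at $0$ (all its derivatives vanish at $0$). (1) Suppose $\partial_1^{\alpha_1}\partial_2^{\alpha_2}\phi(0,0)=0$ for all $\alpha\in\mathbb{Z}_+^2$ with $|\alpha|\le2$, $h(\phi)\le2$ and $h_{lin}(\phi)<h(\phi)$. Then $\phi$ satisfies $(D_{m,n})$ for some $m,n$; and for all $m,n$ such that $\phi$ satisfies $(D_{m,n})$ one has $h(\phi)=\frac{2n}{n+1}$ (read as $h(\phi)=2$ when $n=\infty$) and $h_{lin}(\phi)=\frac{2m+1}{m+1}$. (2) Conversely, if $\phi$ satisfies $(D_{m,n})$ for some $m,n$, then $\partial_1^{\alpha_1}\partial_2^{\alpha_2}\phi(0,0)=0$ for all $\alpha\in\mathbb{Z}_+^2$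 with $|\alpha|\le2$, $h(\phi)\le2$ and $h_{lin}(\phi)<h(\phi)$. -/

import Mathlib

open Filter Topology
open scoped ContDiff ENNReal

/-- `f` is (real) `C^∞` on some open neighbourhood of `x`. -/
def SmoothNear {E F : Type*} [NormedAddCommGroup E] [NormedSpace ℝ E]
    [NormedAddCommGroup F] [NormedSpace ℝ F] (f : E → F) (x : E) : Prop :=
  ∃ U : Set E, IsOpen U ∧ x ∈ U ∧ ContDiffOn ℝ ∞ f U

/-- The partial derivative `∂₁^i ∂₂^j f (0, 0)`. -/
noncomputable def partialAtZero (i j : ℕ) (f : ℝ × ℝ → ℝ) : ℝ :=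
  iteratedDeriv i (fun s => iteratedDeriv j (fun t => f (s, t)) 0) 0

/-- The Taylor coefficient `c_α = ∂^α f (0, 0) / (α₁! α₂!)`. -/
noncomputable def taylorCoeffAtZero (f : ℝ × ℝ → ℝ) (α : ℕ × ℕ) : ℝ :=
  1 / ((Nat.factorial α.1 : ℝ) * (Nat.factorial α.2 : ℝ)) * partialAtZero α.1 α.2 f

/-- The Taylor support of `f` at the origin. -/
def taylorSupport (f : ℝ × ℝ → ℝ) : Set (ℕ × ℕ) :=
  {α | α ≠ (0, 0) ∧ taylorCoeffAtZero f α ≠ 0}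

/-- The Newton polyhedron: the convex hull of the union of all the octants `α + ℝ₊²`, with `α`
in the Taylor support. -/
def newtonPolyhedron (f : ℝ × ℝ → ℝ) : Set (ℝ × ℝ) :=
  convexHull ℝ (⋃ α ∈ taylorSupport f, {t : ℝ × ℝ | (α.1 : ℝ) ≤ t.1 ∧ (α.2 : ℝ) ≤ t.2})

/-- The Newton distance: the number `d` such that the bisectrix `t₁ = t₂` meets the boundary of the
Newton polyhedron at `(d, d)`. As the polyhedron is stable under adding `ℝ₊²`, this is the least
`d` with `(d, d)` in the polyhedron (see `newtonDist_eq_of_mem_frontier`). It is `∞` when the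
polyhedron is empty, that is, when the Taylor series vanishes. -/
noncomputable def newtonDist (f : ℝ × ℝ → ℝ) : ℝ≥0∞ :=
  ⨅ (d : ℝ) (_ : (d, d) ∈ newtonPolyhedron f), ENNReal.ofReal d

theorem newtonPolyhedron_upward (f : ℝ × ℝ → ℝ) {p q : ℝ × ℝ} (hp : p ∈ newtonPolyhedron f)
    (h1 : p.1 ≤ q.1) (h2 : p.2 ≤ q.2) : q ∈ newtonPolyhedron f := by
  have key : newtonPolyhedron f ⊆ (fun t : ℝ × ℝ => t + (q - p)) ⁻¹' newtonPolyhedron f := by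
    refine convexHull_min ?_ ?_
    · intro t ht
      refine subset_convexHull ℝ _ ?_
      simp only [Set.mem_iUnion, Set.mem_ofPred_eq] at ht ⊢
      obtain ⟨α, hα, ha, hb⟩ := ht
      refine ⟨α, hα, ?_, ?_⟩
      · simp only [Prod.fst_add, Prod.fst_sub]; linarith
      · simp only [Prod.snd_add, Prod.snd_sub]; linarith
    · exact (convex_convexHull ℝ _).translate_preimage_left _
  simpa using key hp

theorem newtonDist_eq_of_mem_frontier (f : ℝ × ℝ → ℝ) {d : ℝ}
    (hd : (d, d) ∈ frontier (newtonPolyhedron f)) : newtonDist f = ENNReal.ofReal d := by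
  apply le_antisymm
  · have hlt : ∀ e : ℝ, d < e → newtonDist f ≤ ENNReal.ofReal e := by
      intro e he
      have hnhds : {p : ℝ × ℝ | p.1 < e ∧ p.2 < e} ∈ 𝓝 (d, d) :=
        ((isOpen_lt continuous_fst continuous_const).inter
          (isOpen_lt continuous_snd continuous_const)).mem_nhds ⟨he, he⟩
      obtain ⟨p, hp, hpN⟩ := mem_closure_iff_nhds.1 hd.1 _ hnhds
      exact iInf₂_le e (newtonPolyhedron_upward f hpN hp.1.le hp.2.le)
    have hcont : Tendsto ENNReal.ofReal (𝓝[>] d) (𝓝 (ENNReal.ofReal d)) :=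
      (ENNReal.continuous_ofReal.tendsto d).mono_left nhdsWithin_le_nhds
    exact ge_of_tendsto hcont (eventually_nhdsWithin_of_forall hlt)
  · refine le_iInf₂ fun e he => ENNReal.ofReal_le_ofReal ?_
    by_contra hlt
    push Not at hlt
    refine hd.2 (mem_interior.2 ⟨{p : ℝ × ℝ | e < p.1 ∧ e < p.2}, ?_, ?_, hlt, hlt⟩)
    · exact fun p hp => newtonPolyhedron_upward f he hp.1.le hp.2.le
    · exact (isOpen_lt continuous_const continuous_fst).inter
        (isOpen_lt continuous_const continuous_snd)

/-- `Ψ` is a smooth local change of coordinates `x = Ψ(y)` at the origin, preserving the origin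
(by the inverse function theorem, invertibility of the differential is what makes `Ψ` a
diffeomorphism between neighbourhoods of the origin). -/
def IsLocalCoordinateChange (Ψ : ℝ × ℝ → ℝ × ℝ) : Prop :=
  SmoothNear Ψ 0 ∧ Ψ 0 = 0 ∧ (fderiv ℝ Ψ 0).IsInvertible

/-- The height `h(f)`: the supremum of the Newton distances over all smooth local coordinate
systems at the origin. -/
noncomputable def height (f : ℝ × ℝ → ℝ) : ℝ≥0∞ :=
  ⨆ (Ψ : ℝ × ℝ → ℝ × ℝ) (_ : IsLocalCoordinateChange Ψ), newtonDist (f ∘ Ψ)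

/-- The linear height `h_lin(f)`: the supremum of the Newton distances over all linear coordinate
systems. -/
noncomputable def linHeight (f : ℝ × ℝ → ℝ) : ℝ≥0∞ :=
  ⨆ L : (ℝ × ℝ) ≃L[ℝ] (ℝ × ℝ), newtonDist (f ∘ L)

/-- Either `n` is finite and `b₀(t) = t^n β(t)` near `0` with `β` smooth, `β(0) ≠ 0`, or `n = ∞`
and `b₀` is flat at `0`. -/
def HasVanishingOrder (b₀ : ℝ → ℝ) (n : ℕ∞) : Prop :=
  (∃ k : ℕ, n = (k : ℕ∞) ∧ ∃ β : ℝ → ℝ, SmoothNear β 0 ∧ β 0 ≠ 0 ∧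
      ∀ᶠ t in 𝓝 (0 : ℝ), b₀ t = t ^ k * β t) ∨
    (n = ⊤ ∧ ∀ k : ℕ, iteratedDeriv k b₀ 0 = 0)

/-- After a linear change of variables, `φ` has the form
`b(x₁, x₂) (x₂ - x₁^m w(x₁))² + b₀(x₁)` near the origin, where `b, w, b₀` are smooth,
`b(0) = 0`, `∂₁b(0) ≠ 0`, `∂₂b(0) = 0`, `m ≥ 2`, `w(0) ≠ 0`, and `b₀` vanishes exactly to the order
`n` with `2m + 1 < n ≤ ∞`. -/
def HasNormalForm (φ : ℝ × ℝ → ℝ) (m : ℕ) (n : ℕ∞) : Prop :=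
  ∃ (L : (ℝ × ℝ) ≃L[ℝ] (ℝ × ℝ)) (b : ℝ × ℝ → ℝ) (w b₀ : ℝ → ℝ),
    SmoothNear b 0 ∧ SmoothNear w 0 ∧ SmoothNear b₀ 0 ∧
    (∀ᶠ x in 𝓝 (0 : ℝ × ℝ), φ (L x) = b x * (x.2 - x.1 ^ m * w x.1) ^ 2 + b₀ x.1) ∧
    b 0 = 0 ∧ partialAtZero 1 0 b ≠ 0 ∧ partialAtZero 0 1 b = 0 ∧
    2 ≤ m ∧ w 0 ≠ 0 ∧
    ((2 * m + 1 : ℕ) : ℕ∞) < n ∧ HasVanishingOrder b₀ n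

/-!
Call `P` the initial form of `f` of weight `(p, q)` and degree `k` if
`f (ε ^ p * x₁, ε ^ q * x₂) / ε ^ k → P x` as `ε → 0+`. Initial forms are stable under
substitution, so they control the Newton distance in every coordinate system at once.

If `φ` has the normal form `(D_{m,n})`, it is equivalent to `x₁ x₂ ^ 2 + β x₁ ^ n` up to terms above
the Newton edge from `(1, 2)` to `(n, 0)`, which meets the diagonal at `2n / (n + 1)`. Any further
change of coordinates keeps a monomial on or below that edge on each side of the diagonal, so this
is the height. Linear changes cannot remove the term `x₁ ^ m * ω(x₁)` from the square, and the
vertex `(2m + 1, 0)` it creates bounds the linear height by `(2m + 1) / (m + 1)`.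

Conversely, `h_lin < h ≤ 2` forces the cubic part of `φ` to be nonzero with a double but no triple
root: in all other cases a linear change already attains the height. In coordinates where the cubic
part is `c x₁ x₂ ^ 2`, the curve of critical points of `x₂ ↦ φ(x₁, x₂)`, found by the implicit
function theorem after blowing up, is the root `x₂ = x₁ ^ m * ω(x₁)` of the normal form, and
`n ≤ 2m + 1` would again give `h_lin = h`.
-/

section Hadamard

variable {E G : Type*} [NormedAddCommGroup E] [NormedSpace ℝ E]
  [NormedAddCommGroup G] [NormedSpace ℝ G]

theorem hasFDerivAt_intervalIntegral_of_contDiff [ProperSpace E] {F : E × ℝ → G}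
    (hF : ContDiff ℝ 1 F) (a b : ℝ) (x₀ : E) :
    HasFDerivAt (fun x => ∫ t in a..b, F (x, t))
      (∫ t in a..b, (fderiv ℝ F (x₀, t)).comp (ContinuousLinearMap.inl ℝ E ℝ)) x₀ := by
  have hF' : Continuous fun z : E × ℝ =>
      (fderiv ℝ F z).comp (ContinuousLinearMap.inl ℝ E ℝ) :=
    (hF.continuous_fderiv one_ne_zero).clm_comp continuous_const
  have slice : ∀ x : E, Continuous fun t : ℝ => (x, t) := fun x => by fun_prop
  obtain ⟨C, hC⟩ := ((isCompact_closedBall x₀ 1).prod (isCompact_uIcc (a := a) (b := b))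
    ).exists_bound_of_continuousOn hF'.continuousOn
  refine intervalIntegral.hasFDerivAt_integral_of_dominated_of_fderiv_le (𝕜 := ℝ)
    (F := fun x t => F (x, t))
    (F' := fun x t => (fderiv ℝ F (x, t)).comp (ContinuousLinearMap.inl ℝ E ℝ))
    (bound := fun _ => C) (Metric.closedBall_mem_nhds x₀ one_pos)
    (Eventually.of_forall fun x => (hF.continuous.comp (slice x)).aestronglyMeasurable)
    ((hF.continuous.comp (slice x₀)).intervalIntegrable _ _)
    (hF'.comp (slice x₀)).aestronglyMeasurable
    (Eventually.of_forall fun t ht x hx => hC (x, t) ⟨hx, Set.uIoc_subset_uIcc ht⟩)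
    intervalIntegrable_const (Eventually.of_forall fun t _ x _ => ?_)
  exact (hF.differentiable one_ne_zero (x, t)).hasFDerivAt.comp x (hasFDerivAt_prodMk_left x t)

variable [FiniteDimensional ℝ E]

theorem contDiff_intervalIntegral_natCast (n : ℕ) {F : E × ℝ → G} (hF : ContDiff ℝ n F)
    (a b : ℝ) : ContDiff ℝ n fun x => ∫ t in a..b, F (x, t) := by
  induction n generalizing F with
  | zero =>
    rw [Nat.cast_zero, contDiff_zero] at hF ⊢
    exact intervalIntegral.continuous_parametric_intervalIntegral_of_continuous'
      (f := fun x t => F (x, t)) (by simpa [Function.uncurry_def] using hF) a b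
  | succ n ih =>
    have hF1 : ContDiff ℝ 1 F := hF.of_le (by exact_mod_cast Nat.le_add_left 1 n)
    have hD := hasFDerivAt_intervalIntegral_of_contDiff hF1 a b
    rw [Nat.cast_succ, contDiff_succ_iff_fderiv_apply]
    refine ⟨fun x => (hD x).differentiableAt, by simp, fun y => ?_⟩
    have hfderiv : (fun x => fderiv ℝ (fun x => ∫ t in a..b, F (x, t)) x y) =
        fun x => ∫ t in a..b, fderiv ℝ F (x, t) (y, 0) := by
      funext x
      have hcont : Continuous fun t : ℝ =>
          (fderiv ℝ F (x, t)).comp (ContinuousLinearMap.inl ℝ E ℝ) :=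
        ((hF1.continuous_fderiv one_ne_zero).comp (by fun_prop)).clm_comp continuous_const
      rw [(hD x).fderiv, ContinuousLinearMap.intervalIntegral_apply
        (hcont.intervalIntegrable _ _)]
      rfl
    rw [hfderiv]
    exact ih ((hF.fderiv_right (m := n) (by norm_cast)).clm_apply contDiff_const)

theorem contDiff_intervalIntegral {n : ℕ∞} {F : E × ℝ → G} (hF : ContDiff ℝ n F) (a b : ℝ) :
    ContDiff ℝ n fun x => ∫ t in a..b, F (x, t) :=
  contDiff_iff_forall_nat_le.2 fun m hm =>
    contDiff_intervalIntegral_natCast m (hF.of_le (by exact_mod_cast hm)) a b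

variable [CompleteSpace G]

theorem exists_contDiff_eq_add_snd_smul {f : E × ℝ → G} (hf : ContDiff ℝ ∞ f) :
    ∃ g : E × ℝ → G, ContDiff ℝ ∞ g ∧ ∀ z, f z = f (z.1, 0) + z.2 • g z := by
  have hf' : ContDiff ℝ ∞ (fderiv ℝ f) := hf.fderiv_right (by simp)
  refine ⟨fun z => ∫ t in (0 : ℝ)..1, fderiv ℝ f (z.1, t * z.2) (0, 1),
    contDiff_intervalIntegral (n := ⊤)
      (F := fun w : (E × ℝ) × ℝ => fderiv ℝ f (w.1.1, w.2 * w.1.2) (0, 1)) (by fun_prop) 0 1,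
    fun z => ?_⟩
  have hderiv : ∀ t : ℝ, HasDerivAt (fun t : ℝ => f (z.1, t * z.2))
      (z.2 • fderiv ℝ f (z.1, t * z.2) (0, 1)) t := fun t => by
    have hline : HasDerivAt (fun t : ℝ => (z.1, t * z.2)) (0, z.2) t :=
      (hasDerivAt_const t z.1).prodMk (by simpa using (hasDerivAt_id t).mul_const z.2)
    have hcomp := (hf.differentiable (by simp) (z.1, t * z.2)).hasFDerivAt.comp_hasDerivAt t hline
    rwa [show ((0 : E), z.2) = z.2 • ((0 : E), (1 : ℝ)) by simp, map_smul] at hcomp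
  have hcont : Continuous fun t : ℝ => z.2 • fderiv ℝ f (z.1, t * z.2) (0, 1) := by
    have := hf'.continuous
    fun_prop
  have hftc := intervalIntegral.integral_eq_sub_of_hasDerivAt (a := 0) (b := 1)
    (fun t _ => hderiv t) (hcont.intervalIntegrable _ _)
  rw [intervalIntegral.integral_smul, one_mul, zero_mul] at hftc
  rw [hftc, add_sub_cancel]

theorem exists_contDiff_eq_add_id_smul {f : ℝ → G} (hf : ContDiff ℝ ∞ f) :
    ∃ g : ℝ → G, ContDiff ℝ ∞ g ∧ ∀ t, f t = f 0 + t • g t := by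
  obtain ⟨g, hg, hfg⟩ := exists_contDiff_eq_add_snd_smul (f := fun z : ℝ × ℝ => f z.2)
    (by fun_prop)
  exact ⟨fun t => g (0, t), by fun_prop, fun t => hfg (0, t)⟩

end Hadamard

namespace SmoothNear

variable {E F G : Type*} [NormedAddCommGroup E] [NormedSpace ℝ E]
  [NormedAddCommGroup F] [NormedSpace ℝ F] [NormedAddCommGroup G] [NormedSpace ℝ G]

-- In Mathlib `ContDiffAt ℝ ∞ f x` only provides, for each finite order, a neighbourhood of `x`
-- depending on that order; hence the quantification over nearby points.
theorem iff_eventually_contDiffAt {f : E → F} {x : E} :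
    SmoothNear f x ↔ ∀ᶠ y in 𝓝 x, ContDiffAt ℝ ∞ f y := by
  refine ⟨fun ⟨U, hU, hx, hf⟩ => ?_, fun h => ?_⟩
  · filter_upwards [hU.mem_nhds hx] with y hy using hf.contDiffAt (hU.mem_nhds hy)
  · obtain ⟨U, hUf, hU, hx⟩ := eventually_nhds_iff.1 h
    exact ⟨U, hU, hx, fun y hy => (hUf y hy).contDiffWithinAt⟩

theorem of_contDiff {f : E → F} (hf : ContDiff ℝ ∞ f) (x : E) : SmoothNear f x :=
  ⟨Set.univ, isOpen_univ, trivial, hf.contDiffOn⟩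

variable {f g : E → F} {x : E}

theorem contDiffAt (hf : SmoothNear f x) : ContDiffAt ℝ ∞ f x :=
  (iff_eventually_contDiffAt.1 hf).self_of_nhds

theorem continuousAt (hf : SmoothNear f x) : ContinuousAt f x :=
  hf.contDiffAt.continuousAt

theorem differentiableAt (hf : SmoothNear f x) : DifferentiableAt ℝ f x :=
  hf.contDiffAt.differentiableAt (by simp)

theorem congr (hf : SmoothNear f x) (hgf : g =ᶠ[𝓝 x] f) : SmoothNear g x := by
  rw [iff_eventually_contDiffAt] at hf ⊢
  filter_upwards [hf, hgf.eventuallyEq_nhds] with y hy hgfy using hy.congr_of_eventuallyEq hgfy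

theorem prodMk {g : E → G} (hf : SmoothNear f x) (hg : SmoothNear g x) :
    SmoothNear (fun y => (f y, g y)) x := by
  rw [iff_eventually_contDiffAt] at hf hg ⊢
  filter_upwards [hf, hg] with y hfy hgy using hfy.prodMk hgy

theorem comp {f : F → G} {u : E → F} (hf : SmoothNear f (u x)) (hu : SmoothNear u x) :
    SmoothNear (fun y => f (u y)) x := by
  have hux := hu.continuousAt
  rw [iff_eventually_contDiffAt] at hf hu ⊢
  filter_upwards [hux.eventually hf, hu] with y hfy huy using hfy.comp y huy

theorem fst {f : E → F × G} (hf : SmoothNear f x) : SmoothNear (fun y => (f y).1) x :=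
  (of_contDiff contDiff_fst _).comp hf

theorem snd {f : E → F × G} (hf : SmoothNear f x) : SmoothNear (fun y => (f y).2) x :=
  (of_contDiff contDiff_snd _).comp hf

theorem add (hf : SmoothNear f x) (hg : SmoothNear g x) :
    SmoothNear (fun y => f y + g y) x :=
  (of_contDiff contDiff_add _).comp (hf.prodMk hg)

theorem sub (hf : SmoothNear f x) (hg : SmoothNear g x) :
    SmoothNear (fun y => f y - g y) x :=
  (of_contDiff (contDiff_fst.sub contDiff_snd) _).comp (hf.prodMk hg)

theorem mul {f g : E → ℝ} (hf : SmoothNear f x) (hg : SmoothNear g x) :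
    SmoothNear (fun y => f y * g y) x :=
  (of_contDiff contDiff_mul _).comp (hf.prodMk hg)

theorem pow {f : E → ℝ} (hf : SmoothNear f x) (n : ℕ) : SmoothNear (fun y => f y ^ n) x :=
  (of_contDiff (contDiff_id.pow n) _).comp hf

theorem exists_contDiff [FiniteDimensional ℝ E] (hf : SmoothNear f x) :
    ∃ g : E → F, ContDiff ℝ ∞ g ∧ f =ᶠ[𝓝 x] g := by
  obtain ⟨U, hU, hx, hf⟩ := hf
  obtain ⟨r, hr, hrU⟩ := Metric.nhds_basis_closedBall.mem_iff.1 (hU.mem_nhds hx)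
  let χ : ContDiffBump x := ⟨r / 2, r, by positivity, by linarith⟩
  refine ⟨fun y => χ y • f y, contDiff_iff_contDiffAt.2 fun y => ?_, ?_⟩
  · by_cases hy : y ∈ U
    · exact χ.contDiff.contDiffAt.smul (hf.contDiffAt (hU.mem_nhds hy))
    · have hy' : y ∈ (tsupport χ)ᶜ := by
        rw [χ.tsupport_eq]
        exact fun hy' => hy (hrU hy')
      refine (contDiffAt_const (c := 0)).congr_of_eventuallyEq ?_
      filter_upwards [(isClosed_tsupport _).isOpen_compl.mem_nhds hy'] with z hz
      rw [image_eq_zero_of_notMem_tsupport hz, zero_smul]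
  · filter_upwards [χ.eventuallyEq_one] with y hy
    simp [hy]

end SmoothNear

section Taylor

theorem iteratedDeriv_succ_add_id_mul {g : ℝ → ℝ} {n : ℕ} (hg : ContDiffAt ℝ (n + 1 : ℕ) g 0)
    (c : ℝ) : iteratedDeriv (n + 1) (fun t => c + t * g t) 0 = (n + 1) * iteratedDeriv n g 0 := by
  rw [iteratedDeriv_const_add n.succ_pos, iteratedDeriv_fun_mul contDiffAt_fun_id hg,
    Finset.sum_eq_single_of_mem 1 (by simp) fun i _ hi => by simp [iteratedDeriv_fun_id_zero, hi]]
  simp [iteratedDeriv_fun_id_zero]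

theorem iteratedDeriv_succ_div_factorial {f g : ℝ → ℝ} {n : ℕ} {c : ℝ}
    (hg : ContDiffAt ℝ (n + 1 : ℕ) g 0) (hfg : ∀ t, f t = c + t * g t) :
    iteratedDeriv (n + 1) f 0 / (n + 1).factorial = iteratedDeriv n g 0 / n.factorial := by
  rw [funext hfg, iteratedDeriv_succ_add_id_mul hg, Nat.factorial_succ, Nat.cast_mul,
    Nat.cast_succ, mul_div_mul_left _ _ n.cast_add_one_ne_zero]

theorem partialAtZero_congr {f g : ℝ × ℝ → ℝ} (h : f =ᶠ[𝓝 0] g) (i j : ℕ) :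
    partialAtZero i j f = partialAtZero i j g := by
  have h' : ∀ᶠ x in 𝓝 ((0 : ℝ), (0 : ℝ)), f x = g x := h
  refine EventuallyEq.iteratedDeriv_eq i ?_
  filter_upwards [h'.curry_nhds] with s hs using EventuallyEq.iteratedDeriv_eq j hs

theorem taylorCoeffAtZero_congr {f g : ℝ × ℝ → ℝ} (h : f =ᶠ[𝓝 0] g) (α : ℕ × ℕ) :
    taylorCoeffAtZero f α = taylorCoeffAtZero g α := by
  rw [taylorCoeffAtZero, taylorCoeffAtZero, partialAtZero_congr h]

theorem taylorCoeffAtZero_eq_zero_iff {f : ℝ × ℝ → ℝ} {i j : ℕ} :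
    taylorCoeffAtZero f (i, j) = 0 ↔ partialAtZero i j f = 0 := by
  simp [taylorCoeffAtZero, Nat.factorial_ne_zero]

theorem taylorCoeffAtZero_eq_iteratedDeriv_div (f : ℝ × ℝ → ℝ) (i j : ℕ) :
    taylorCoeffAtZero f (i, j) =
      iteratedDeriv i (fun s => iteratedDeriv j (fun t => f (s, t)) 0 / j.factorial) 0 /
        i.factorial := by
  rw [iteratedDeriv_div_const, taylorCoeffAtZero, partialAtZero]
  ring

theorem taylorCoeffAtZero_fst (f : ℝ × ℝ → ℝ) (i : ℕ) :
    taylorCoeffAtZero f (i, 0) = iteratedDeriv i (fun s => f (s, 0)) 0 / i.factorial := by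
  simp [taylorCoeffAtZero_eq_iteratedDeriv_div]

theorem taylorCoeffAtZero_zero_zero (f : ℝ × ℝ → ℝ) : taylorCoeffAtZero f (0, 0) = f 0 := by
  rw [taylorCoeffAtZero_fst]
  simp [Prod.mk_zero_zero]

theorem taylorCoeffAtZero_succ_snd {f g : ℝ × ℝ → ℝ} (hg : ContDiff ℝ ∞ g) {k : ℝ → ℝ}
    (hfg : ∀ x, f x = k x.1 + x.2 * g x) (i j : ℕ) :
    taylorCoeffAtZero f (i, j + 1) = taylorCoeffAtZero g (i, j) := by
  have hslice (s : ℝ) : iteratedDeriv (j + 1) (fun t => f (s, t)) 0 / (j + 1).factorial =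
      iteratedDeriv j (fun t => g (s, t)) 0 / j.factorial :=
    iteratedDeriv_succ_div_factorial
      ((hg.of_le (by exact_mod_cast le_top)).comp (contDiff_prodMk_right s)).contDiffAt
      fun t => hfg (s, t)
  simp only [taylorCoeffAtZero_eq_iteratedDeriv_div, hslice]

theorem contDiff_iteratedDeriv_snd {g : ℝ × ℝ → ℝ} (hg : ContDiff ℝ ∞ g) (j : ℕ) :
    ContDiff ℝ ∞ fun s : ℝ => iteratedDeriv j (fun t => g (s, t)) 0 := by
  induction j generalizing g with
  | zero => simpa using (by fun_prop : ContDiff ℝ ∞ fun s : ℝ => g (s, 0))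
  | succ j ih =>
    have hg' : ContDiff ℝ ∞ fun x : ℝ × ℝ => fderiv ℝ g x (0, 1) := by
      have := hg.fderiv_right (m := ∞) (by simp)
      fun_prop
    convert ih hg' using 2 with s
    rw [iteratedDeriv_succ']
    congr 1
    funext t
    exact ((hg.differentiable (by simp) (s, t)).hasFDerivAt.comp_hasDerivAt t
      ((hasDerivAt_const t s).prodMk (hasDerivAt_id t))).deriv

theorem taylorCoeffAtZero_succ_fst {f g : ℝ × ℝ → ℝ} (hg : ContDiff ℝ ∞ g) {k : ℝ → ℝ}
    (hk : ContDiff ℝ ∞ k) (hfg : ∀ x, f x = k x.2 + x.1 * g x) (i j : ℕ) :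
    taylorCoeffAtZero f (i + 1, j) = taylorCoeffAtZero g (i, j) := by
  have hg' (s : ℝ) : ContDiff ℝ j fun t => g (s, t) :=
    (hg.comp (contDiff_prodMk_right s)).of_le (by exact_mod_cast le_top)
  have hk' : ContDiff ℝ j k := hk.of_le (by exact_mod_cast le_top)
  have hslice (s : ℝ) : iteratedDeriv j (fun t => f (s, t)) 0 / j.factorial =
      iteratedDeriv j k 0 / j.factorial +
        s * (iteratedDeriv j (fun t => g (s, t)) 0 / j.factorial) := by
    simp only [hfg]
    rw [iteratedDeriv_fun_add hk'.contDiffAt (contDiff_const.mul (hg' s)).contDiffAt,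
      iteratedDeriv_const_mul_field, add_div, mul_div_assoc]
  rw [taylorCoeffAtZero_eq_iteratedDeriv_div, taylorCoeffAtZero_eq_iteratedDeriv_div]
  exact iteratedDeriv_succ_div_factorial
    (((contDiff_iteratedDeriv_snd hg j).div_const _).of_le (by exact_mod_cast le_top)).contDiffAt
    hslice

theorem SmoothNear.comp_swap {f : ℝ × ℝ → ℝ} (hf : SmoothNear f 0) :
    SmoothNear (fun x : ℝ × ℝ => f x.swap) 0 :=
  SmoothNear.comp (f := f) (x := (0 : ℝ × ℝ)) (u := Prod.swap) hf
    (.of_contDiff (contDiff_snd.prodMk contDiff_fst) 0)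

theorem taylorCoeffAtZero_swap_of_contDiff {f : ℝ × ℝ → ℝ} (hf : ContDiff ℝ ∞ f) (i j : ℕ) :
    taylorCoeffAtZero (fun x => f x.swap) (i, j) = taylorCoeffAtZero f (j, i) := by
  induction i generalizing f with
  | zero => simp [taylorCoeffAtZero, partialAtZero]
  | succ i ih =>
    obtain ⟨g, hg, hfg⟩ := exists_contDiff_eq_add_snd_smul hf
    have hgs : ContDiff ℝ ∞ fun x : ℝ × ℝ => g x.swap :=
      hg.comp (contDiff_snd.prodMk contDiff_fst)
    rw [taylorCoeffAtZero_succ_snd hg (k := fun s => f (s, 0)) hfg, ← ih hg]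
    exact taylorCoeffAtZero_succ_fst hgs (k := fun s => f (s, 0)) (by fun_prop)
      (fun x => hfg x.swap) i j

theorem SmoothNear.taylorCoeffAtZero_swap {f : ℝ × ℝ → ℝ} (hf : SmoothNear f 0) (i j : ℕ) :
    taylorCoeffAtZero (fun x => f x.swap) (i, j) = taylorCoeffAtZero f (j, i) := by
  obtain ⟨F, hF, hfF⟩ := hf.exists_contDiff
  have hswap : (fun x : ℝ × ℝ => f x.swap) =ᶠ[𝓝 0] fun x => F x.swap :=
    (continuous_swap.tendsto (0 : ℝ × ℝ)).eventually hfF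
  rw [taylorCoeffAtZero_congr hswap, taylorCoeffAtZero_congr hfF,
    taylorCoeffAtZero_swap_of_contDiff hF]

theorem sub_taylor_isBigO {f : ℝ → ℝ} {n : ℕ} (hf : ContDiff ℝ n f) :
    (fun t => f t - ∑ i ∈ Finset.range n, iteratedDeriv i f 0 / i.factorial * t ^ i)
      =O[𝓝 0] fun t => t ^ n := by
  have hterm : (fun t : ℝ => iteratedDeriv n f 0 / n.factorial * t ^ n) =O[𝓝 0] fun t => t ^ n :=
    (Asymptotics.isBigO_refl _ _).const_mul_left _
  refine ((taylor_isLittleO_univ hf (x₀ := 0)).isBigO.congr_right fun t => by rw [sub_zero]).add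
    hterm |>.congr_left fun t => ?_
  simp only [taylor_within_apply, iteratedDerivWithin_univ, Finset.sum_range_succ, sub_zero,
    smul_eq_mul]
  have hcomm (i : ℕ) : ((i.factorial : ℝ)⁻¹ * t ^ i) * iteratedDeriv i f 0 =
      iteratedDeriv i f 0 / i.factorial * t ^ i := by ring
  simp only [hcomm]
  ring

theorem sub_taylor_prod_isBigO {f : ℝ × ℝ → ℝ} (hf : ContDiff ℝ ∞ f) {m n : ℕ} (hnm : n ≤ m) :
    (fun x => f x - ∑ j ∈ Finset.range n, ∑ i ∈ Finset.range m,
      taylorCoeffAtZero f (i, j) * (x.1 ^ i * x.2 ^ j)) =O[𝓝 0] fun x => ‖x‖ ^ n := by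
  induction n generalizing f with
  | zero => simpa using (hf.continuous.tendsto 0).isBigO_one ℝ
  | succ n ih =>
    obtain ⟨g, hg, hfg⟩ := exists_contDiff_eq_add_snd_smul hf
    have hfst : (fun x : ℝ × ℝ => x.1 ^ m) =O[𝓝 0] fun x => ‖x‖ ^ (n + 1) := by
      refine .of_bound 1 ?_
      filter_upwards [tendsto_norm_zero.eventually (gt_mem_nhds one_pos)] with x hx
      rw [one_mul, norm_pow, norm_pow, norm_norm]
      exact (pow_le_pow_left₀ (norm_nonneg _) (norm_fst_le x) m).trans
        (pow_le_pow_of_le_one (norm_nonneg x) hx.le hnm)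
    have hsnd : (fun x : ℝ × ℝ => x.2) =O[𝓝 0] fun x => ‖x‖ :=
      Asymptotics.isBigO_of_le _ fun x => by simpa using norm_snd_le x
    have haxis := (sub_taylor_isBigO (f := fun s => f (s, 0)) (n := m)
      (by have := hf.of_le (m := m) (by exact_mod_cast le_top); fun_prop)).comp_tendsto
      (continuous_fst.tendsto (0 : ℝ × ℝ))
    refine ((haxis.trans hfst).add ((hsnd.mul (ih hg (n.le_succ.trans hnm))).congr_right
      fun x => (pow_succ' ‖x‖ n).symm)).congr_left fun x => ?_
    have hshift (i j : ℕ) : x.2 * (taylorCoeffAtZero g (i, j) * (x.1 ^ i * x.2 ^ j)) =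
        taylorCoeffAtZero g (i, j) * (x.1 ^ i * x.2 ^ (j + 1)) := by ring
    simp only [Finset.sum_range_succ', taylorCoeffAtZero_succ_snd hg (k := fun s => f (s, 0)) hfg,
      taylorCoeffAtZero_fst, pow_zero, mul_one, Function.comp, mul_sub, Finset.mul_sum, hshift]
    rw [hfg x, smul_eq_mul]
    ring

end Taylor

/-- `f` has weighted order at least `k` at the origin for the weights `(p, q)`, and `P` is its
weighted homogeneous part of degree `k` (possibly zero). It is expressed through the scaling limit
`f (ε ^ p * x₁, ε ^ q * x₂) / ε ^ k → P x`, taken locally uniformly in `x` so that it is stable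
under substitution. -/
def HasInitialForm (f : ℝ × ℝ → ℝ) (p q k : ℕ) (P : ℝ × ℝ → ℝ) : Prop :=
  ∀ x : ℝ × ℝ, Tendsto (fun z : ℝ × (ℝ × ℝ) => f (z.1 ^ p * z.2.1, z.1 ^ q * z.2.2) / z.1 ^ k)
    (𝓝[>] 0 ×ˢ 𝓝 x) (𝓝 (P x))

namespace HasInitialForm

variable {f g : ℝ × ℝ → ℝ} {p q k l : ℕ} {P Q : ℝ × ℝ → ℝ}

theorem eventually_pos (x : ℝ × ℝ) : ∀ᶠ z : ℝ × (ℝ × ℝ) in 𝓝[>] 0 ×ˢ 𝓝 x, 0 < z.1 :=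
  tendsto_fst.eventually (self_mem_nhdsWithin : Set.Ioi (0 : ℝ) ∈ 𝓝[>] 0)

theorem tendsto_fst_zero (x : ℝ × ℝ) :
    Tendsto (fun z : ℝ × (ℝ × ℝ) => z.1) (𝓝[>] 0 ×ˢ 𝓝 x) (𝓝 0) :=
  tendsto_fst.mono_right nhdsWithin_le_nhds

theorem tendsto_scaling (hp : 0 < p) (hq : 0 < q) (x : ℝ × ℝ) :
    Tendsto (fun z : ℝ × (ℝ × ℝ) => (z.1 ^ p * z.2.1, z.1 ^ q * z.2.2)) (𝓝[>] 0 ×ˢ 𝓝 x)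
      (𝓝 (0 : ℝ × ℝ)) := by
  have hfst : Tendsto (fun z : ℝ × (ℝ × ℝ) => z.2.1) (𝓝[>] 0 ×ˢ 𝓝 x) (𝓝 x.1) :=
    (continuous_fst.tendsto x).comp tendsto_snd
  have hsnd : Tendsto (fun z : ℝ × (ℝ × ℝ) => z.2.2) (𝓝[>] 0 ×ˢ 𝓝 x) (𝓝 x.2) :=
    (continuous_snd.tendsto x).comp tendsto_snd
  simpa [hp.ne', hq.ne', Prod.mk_zero_zero] using
    (((tendsto_fst_zero x).pow p).mul hfst).prodMk_nhds (((tendsto_fst_zero x).pow q).mul hsnd)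

theorem congr (hp : 0 < p) (hq : 0 < q) (h : HasInitialForm f p q k P) (hfg : g =ᶠ[𝓝 0] f) :
    HasInitialForm g p q k P := fun x =>
  (h x).congr' (((tendsto_scaling hp hq x).eventually hfg).mono fun z hz => by simp only [hz])

theorem congr_right (h : HasInitialForm f p q k P) (hPQ : ∀ x, P x = Q x) :
    HasInitialForm f p q k Q := by
  rwa [← funext hPQ]

theorem unique (hP : HasInitialForm f p q k P) (hQ : HasInitialForm f p q k Q) : P = Q :=
  funext fun x => tendsto_nhds_unique (hP x) (hQ x)

theorem add (hf : HasInitialForm f p q k P) (hg : HasInitialForm g p q k Q) :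
    HasInitialForm (fun x => f x + g x) p q k (fun x => P x + Q x) := fun x =>
  ((hf x).add (hg x)).congr fun _ => (add_div _ _ _).symm

theorem sub (hf : HasInitialForm f p q k P) (hg : HasInitialForm g p q k Q) :
    HasInitialForm (fun x => f x - g x) p q k (fun x => P x - Q x) := fun x =>
  ((hf x).sub (hg x)).congr fun _ => (sub_div _ _ _).symm

theorem mul (hf : HasInitialForm f p q k P) (hg : HasInitialForm g p q l Q) :
    HasInitialForm (fun x => f x * g x) p q (k + l) (fun x => P x * Q x) := fun x =>
  ((hf x).mul (hg x)).congr fun z => by rw [pow_add, mul_div_mul_comm]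

theorem pow (hf : HasInitialForm f p q k P) (n : ℕ) :
    HasInitialForm (fun x => f x ^ n) p q (n * k) (fun x => P x ^ n) := fun x =>
  ((hf x).pow n).congr fun z => by rw [div_pow, mul_comm n k, pow_mul]

theorem sum {ι : Type*} (s : Finset ι) {F R : ι → ℝ × ℝ → ℝ}
    (h : ∀ i ∈ s, HasInitialForm (F i) p q k (R i)) :
    HasInitialForm (fun x => ∑ i ∈ s, F i x) p q k (fun x => ∑ i ∈ s, R i x) := fun x =>
  (tendsto_finsetSum s fun i hi => h i hi x).congr fun z => by rw [Finset.sum_div]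

theorem of_lt (h : HasInitialForm f p q k P) (hlk : l < k) :
    HasInitialForm f p q l (fun _ => 0) := fun x => by
  have hlim := ((tendsto_fst_zero x).pow (k - l)).mul (h x)
  rw [zero_pow (Nat.sub_ne_zero_of_lt hlk), zero_mul] at hlim
  refine hlim.congr' ((eventually_pos x).mono fun z hz => ?_)
  rw [← Nat.sub_add_cancel hlk.le, pow_add, Nat.add_sub_cancel]
  field_simp

theorem fst (q : ℕ) : HasInitialForm (fun x => x.1) p q p (fun x => x.1) := fun x =>
  ((continuous_fst.tendsto x).comp tendsto_snd).congr'
    ((eventually_pos x).mono fun z hz => by simp [hz.ne'])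

theorem snd (p : ℕ) : HasInitialForm (fun x => x.2) p q q (fun x => x.2) := fun x =>
  ((continuous_snd.tendsto x).comp tendsto_snd).congr'
    ((eventually_pos x).mono fun z hz => by simp [hz.ne'])

theorem const (c : ℝ) : HasInitialForm (fun _ => c) p q 0 (fun _ => c) := fun x => by
  simp

theorem const_mul (c : ℝ) (h : HasInitialForm f p q k P) :
    HasInitialForm (fun x => c * f x) p q k (fun x => c * P x) := by
  simpa using (const c).mul h

theorem of_continuousAt (hp : 0 < p) (hq : 0 < q) (hf : ContinuousAt f 0) :
    HasInitialForm f p q 0 (fun _ => f 0) := fun x => by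
  simpa [Function.comp_def] using hf.tendsto.comp (tendsto_scaling hp hq x)

theorem comp {p' q' : ℕ} {u v U V : ℝ × ℝ → ℝ} (hf : HasInitialForm f p' q' k P)
    (hu : HasInitialForm u p q p' U) (hv : HasInitialForm v p q q' V) :
    HasInitialForm (fun x => f (u x, v x)) p q k (fun x => P (U x, V x)) := fun x => by
  refine ((hf (U x, V x)).comp (tendsto_fst.prodMk ((hu x).prodMk_nhds (hv x)))).congr'
    ((eventually_pos x).mono fun z hz => ?_)
  simp only [Function.comp]
  rw [mul_div_cancel₀ _ (pow_pos hz p').ne', mul_div_cancel₀ _ (pow_pos hz q').ne']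

theorem monomial (i j : ℕ) : HasInitialForm (fun x => x.1 ^ i * x.2 ^ j) p q (p * i + q * j)
    (fun x => x.1 ^ i * x.2 ^ j) := by
  have h := ((fst (p := p) q).pow i).mul ((snd (q := q) p).pow j)
  rwa [mul_comm i, mul_comm j] at h

theorem norm_scaling_le (hp : 0 < p) (hq : 0 < q) {z : ℝ × (ℝ × ℝ)} (hz : 0 < z.1)
    (hz1 : z.1 < 1) : ‖(z.1 ^ p * z.2.1, z.1 ^ q * z.2.2)‖ ≤ z.1 * ‖z.2‖ := by
  have hcoord : ∀ r : ℕ, 0 < r → ∀ y : ℝ, |y| ≤ ‖z.2‖ → |z.1 ^ r * y| ≤ z.1 * ‖z.2‖ := by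
    intro r hr y hy
    rw [abs_mul, abs_of_pos (by positivity)]
    gcongr
    exact pow_le_of_le_one hz.le hz1.le hr.ne'
  exact max_le (hcoord p hp _ (norm_fst_le z.2)) (hcoord q hq _ (norm_snd_le z.2))

theorem of_isBigO (hp : 0 < p) (hq : 0 < q) {n : ℕ} (hkn : k < n)
    (hf : f =O[𝓝 0] fun x => ‖x‖ ^ n) : HasInitialForm f p q k (fun _ => 0) := fun x => by
  have hscaling : (fun z : ℝ × (ℝ × ℝ) => ‖(z.1 ^ p * z.2.1, z.1 ^ q * z.2.2)‖)
      =O[𝓝[>] 0 ×ˢ 𝓝 x] fun z => z.1 * ‖z.2‖ := by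
    refine Asymptotics.IsBigO.of_bound 1 ?_
    filter_upwards [eventually_pos x, (tendsto_fst_zero x).eventually (gt_mem_nhds one_pos)]
      with z hz hz1
    rw [norm_norm, one_mul, Real.norm_of_nonneg (by positivity)]
    exact norm_scaling_le hp hq hz hz1
  have hbounded : (fun z : ℝ × (ℝ × ℝ) => ‖z.2‖) =O[𝓝[>] 0 ×ˢ 𝓝 x] fun _ => (1 : ℝ) :=
    ((continuous_norm.tendsto x).comp tendsto_snd).isBigO_one ℝ
  have hpow : (fun z : ℝ × (ℝ × ℝ) => f (z.1 ^ p * z.2.1, z.1 ^ q * z.2.2))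
      =O[𝓝[>] 0 ×ˢ 𝓝 x] fun z => z.1 ^ n :=
    (hf.comp_tendsto (tendsto_scaling hp hq x)).trans <| (hscaling.trans <|
      (((Asymptotics.isBigO_refl _ _).mul hbounded).congr_right fun z => mul_one z.1)).pow n
  have hquot := hpow.mul (Asymptotics.isBigO_refl (fun z : ℝ × (ℝ × ℝ) => (z.1 ^ k)⁻¹) _)
  have hzero : Tendsto (fun z : ℝ × (ℝ × ℝ) => z.1 ^ (n - k)) (𝓝[>] 0 ×ˢ 𝓝 x) (𝓝 0) := by
    simpa [Nat.sub_ne_zero_of_lt hkn] using (tendsto_fst_zero x).pow (n - k)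
  exact (hquot.trans_tendsto (hzero.congr' ((eventually_pos x).mono fun z hz =>
    pow_sub₀ _ hz.ne' hkn.le))).congr fun z => (div_eq_mul_inv _ _).symm

end HasInitialForm

/-- The weighted homogeneous part of degree `k`, for the weights `(p, q)`, of the Taylor series of
`f` at the origin. The summation range is exhaustive only for positive weights. -/
noncomputable def weightedPart (f : ℝ × ℝ → ℝ) (p q k : ℕ) (x : ℝ × ℝ) : ℝ :=
  ∑ α ∈ Finset.range (k + 1) ×ˢ Finset.range (k + 1) with p * α.1 + q * α.2 = k,
    taylorCoeffAtZero f α * (x.1 ^ α.1 * x.2 ^ α.2)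

section InitialForm

variable {f : ℝ × ℝ → ℝ} {p q k : ℕ}

theorem SmoothNear.hasInitialForm_weightedPart (hf : SmoothNear f 0) (hp : 0 < p) (hq : 0 < q)
    (h : ∀ i j, p * i + q * j < k → taylorCoeffAtZero f (i, j) = 0) :
    HasInitialForm f p q k (weightedPart f p q k) := by
  obtain ⟨F, hF, hfF⟩ := hf.exists_contDiff
  have hremainder := HasInitialForm.of_isBigO hp hq k.lt_succ_self
    (sub_taylor_prod_isBigO hF (le_refl (k + 1)))
  have hterm (α : ℕ × ℕ) : HasInitialForm (fun x => taylorCoeffAtZero f α *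
      (x.1 ^ α.1 * x.2 ^ α.2)) p q k (fun x => if p * α.1 + q * α.2 = k then
        taylorCoeffAtZero f α * (x.1 ^ α.1 * x.2 ^ α.2) else 0) := by
    rcases lt_trichotomy (p * α.1 + q * α.2) k with hlt | rfl | hgt
    · simpa [h α.1 α.2 hlt] using
        HasInitialForm.of_isBigO (f := fun _ => 0) hp hq k.lt_succ_self
          (Asymptotics.isBigO_zero _ _)
    · simpa using (HasInitialForm.monomial α.1 α.2).const_mul (taylorCoeffAtZero f α)
    · simpa only [hgt.ne', if_false] using ((HasInitialForm.monomial α.1 α.2).const_mul _).of_lt hgt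
  refine ((hremainder.add (HasInitialForm.sum (Finset.range (k + 1) ×ˢ Finset.range (k + 1))
    fun α _ => hterm α)).congr hp hq (hfF.mono fun x hx => ?_)).congr_right fun x => ?_
  · simp only [taylorCoeffAtZero_congr hfF, Finset.sum_product_right]
    rw [hx, sub_add_cancel]
  · rw [zero_add, weightedPart, Finset.sum_filter]

theorem taylorCoeffAtZero_eq_coeff_of_weightedPart (hp : 0 < p) (hq : 0 < q) {Q : Polynomial ℝ}
    (hQ : ∀ t, weightedPart f p q k (t, 1) = Q.eval t) {i j : ℕ} (hij : p * i + q * j = k) :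
    taylorCoeffAtZero f (i, j) = Q.coeff i := by
  have hQeq : Q = ∑ α ∈ Finset.range (k + 1) ×ˢ Finset.range (k + 1) with
      p * α.1 + q * α.2 = k, Polynomial.C (taylorCoeffAtZero f α) * Polynomial.X ^ α.1 :=
    Polynomial.funext fun t => by simp [← hQ, weightedPart, Polynomial.eval_finsetSum]
  have hi : i ≤ p * i := Nat.le_mul_of_pos_left _ hp
  have hj : j ≤ q * j := Nat.le_mul_of_pos_left _ hq
  have hmem : (i, j) ∈ (Finset.range (k + 1) ×ˢ Finset.range (k + 1)).filter
      fun α => p * α.1 + q * α.2 = k := by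
    simp only [Finset.mem_filter, Finset.mem_product, Finset.mem_range]
    omega
  rw [hQeq, Polynomial.finsetSum_coeff, Finset.sum_eq_single_of_mem _ hmem]
  · simp
  · intro α hα hne
    have hα1 : i ≠ α.1 := by
      rintro rfl
      refine hne (Prod.ext rfl (Nat.eq_of_mul_eq_mul_left hq ?_))
      have hα : p * α.1 + q * α.2 = k := (Finset.mem_filter.1 hα).2
      exact Nat.add_left_cancel (hα.trans hij.symm)
    simp [Polynomial.coeff_X_pow, hα1]

theorem HasInitialForm.taylorCoeffAtZero_eq_zero {P : ℝ × ℝ → ℝ} (h : HasInitialForm f p q k P)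
    (hf : SmoothNear f 0) (hp : 0 < p) (hq : 0 < q) {i j : ℕ} (hij : p * i + q * j < k) :
    taylorCoeffAtZero f (i, j) = 0 := by
  suffices ∀ l i j, p * i + q * j = l → l < k → taylorCoeffAtZero f (i, j) = 0 from
    this _ i j rfl hij
  intro l
  induction l using Nat.strong_induction_on with
  | _ l ih =>
    intro i j hij hl
    have hpart := hf.hasInitialForm_weightedPart hp hq (k := l) fun i' j' hlt =>
      ih _ hlt i' j' rfl (hlt.trans hl)
    simpa using taylorCoeffAtZero_eq_coeff_of_weightedPart (Q := 0) hp hq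
      (fun t => by simpa using congrFun (hpart.unique (h.of_lt hl)) (t, 1)) hij

theorem HasInitialForm.taylorCoeffAtZero_eq {P : ℝ × ℝ → ℝ} (h : HasInitialForm f p q k P)
    (hf : SmoothNear f 0) (hp : 0 < p) (hq : 0 < q) {Q : Polynomial ℝ}
    (hQ : ∀ t, P (t, 1) = Q.eval t) {i j : ℕ} (hij : p * i + q * j = k) :
    taylorCoeffAtZero f (i, j) = Q.coeff i := by
  have hpart := hf.hasInitialForm_weightedPart hp hq (k := k) fun _ _ =>
    h.taylorCoeffAtZero_eq_zero hf hp hq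
  exact taylorCoeffAtZero_eq_coeff_of_weightedPart hp hq
    (fun t => (congrFun (hpart.unique h) (t, 1)).trans (hQ t)) hij

end InitialForm

theorem exists_contDiff_eq_pow_mul {f : ℝ → ℝ} (hf : ContDiff ℝ ∞ f) {n : ℕ}
    (h : ∀ i < n, iteratedDeriv i f 0 = 0) :
    ∃ g : ℝ → ℝ, ContDiff ℝ ∞ g ∧ (∀ t, f t = t ^ n * g t) ∧
      g 0 = iteratedDeriv n f 0 / n.factorial := by
  induction n generalizing f with
  | zero => exact ⟨f, hf, by simp, by simp⟩
  | succ n ih =>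
    obtain ⟨k, hk, hfk⟩ := exists_contDiff_eq_add_id_smul hf
    have h0 : f 0 = 0 := by simpa using h 0 n.succ_pos
    have hderiv (i : ℕ) :
        iteratedDeriv (i + 1) f 0 / (i + 1).factorial = iteratedDeriv i k 0 / i.factorial :=
      iteratedDeriv_succ_div_factorial (hk.of_le (by exact_mod_cast le_top)).contDiffAt hfk
    obtain ⟨g, hg, hkg, hg0⟩ := ih hk fun i hi => by
      simpa [h (i + 1) (by omega), i.factorial_ne_zero] using (hderiv i).symm
    exact ⟨g, hg, fun t => by rw [hfk, h0, hkg, smul_eq_mul]; ring, by rw [hg0, hderiv]⟩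

section InitialForm

variable {f : ℝ × ℝ → ℝ} {p q : ℕ}

theorem SmoothNear.exists_eventuallyEq_pow_mul_add {n : ℕ} (hf : SmoothNear f 0)
    (h : ∀ i < n, taylorCoeffAtZero f (i, 0) = 0) :
    ∃ (k : ℝ → ℝ) (g : ℝ × ℝ → ℝ), ContDiff ℝ ∞ k ∧ ContDiff ℝ ∞ g ∧
      f =ᶠ[𝓝 0] (fun x => x.1 ^ n * k x.1 + x.2 * g x) ∧
      k 0 = taylorCoeffAtZero f (n, 0) ∧ g 0 = taylorCoeffAtZero f (0, 1) := by
  obtain ⟨F, hF, hfF⟩ := hf.exists_contDiff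
  obtain ⟨g, hg, hFg⟩ := exists_contDiff_eq_add_snd_smul hF
  have hc := taylorCoeffAtZero_congr hfF
  obtain ⟨k, hk, hFk, hk0⟩ := exists_contDiff_eq_pow_mul (f := fun s => F (s, 0)) (n := n)
    (by fun_prop) fun i hi => by
      simpa [hc, taylorCoeffAtZero_fst, i.factorial_ne_zero] using h i hi
  refine ⟨k, g, hk, hg, hfF.trans (.of_forall fun x => ?_), ?_, ?_⟩
  · rw [hFg, hFk, smul_eq_mul]
  · rw [hk0, hc, taylorCoeffAtZero_fst]
  · rw [hc, taylorCoeffAtZero_succ_snd hg (k := fun s => F (s, 0)) hFg,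
      taylorCoeffAtZero_zero_zero]

theorem SmoothNear.hasInitialForm_linear (hf : SmoothNear f 0) (h0 : f 0 = 0) :
    HasInitialForm f 1 1 1 (fun x => taylorCoeffAtZero f (1, 0) * x.1 +
      taylorCoeffAtZero f (0, 1) * x.2) := by
  refine (hf.hasInitialForm_weightedPart one_pos one_pos fun i j hij => ?_).congr_right fun x => ?_
  · obtain ⟨rfl, rfl⟩ : i = 0 ∧ j = 0 := by omega
    rw [taylorCoeffAtZero_zero_zero, h0]
  · simp [weightedPart, Finset.sum_filter, Finset.sum_product_right, Finset.sum_range_succ]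

theorem SmoothNear.hasInitialForm_fst (hf : SmoothNear f 0) (h0 : f 0 = 0) (hp : 0 < p)
    (hpq : p < q) : HasInitialForm f p q p (fun x => taylorCoeffAtZero f (1, 0) * x.1) := by
  obtain ⟨k, g, hk, hg, hfe, hk0, -⟩ := hf.exists_eventuallyEq_pow_mul_add (n := 1) fun i hi => by
    obtain rfl : i = 0 := by omega
    rw [taylorCoeffAtZero_zero_zero, h0]
  have hq : 0 < q := hp.trans hpq
  have haxis : HasInitialForm (fun x => k x.1) p q 0 (fun _ => k 0) :=
    .of_continuousAt hp hq (hk.continuous.comp continuous_fst).continuousAt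
  have hoff : HasInitialForm (fun x => x.2 * g x) p q p (fun _ => 0) :=
    ((HasInitialForm.snd p).mul (.of_continuousAt hp hq hg.continuous.continuousAt)).of_lt hpq
  refine ((((HasInitialForm.fst q).mul haxis).add hoff).congr hp hq ?_).congr_right fun x => ?_
  · simpa using hfe
  · rw [hk0]; ring

theorem SmoothNear.hasInitialForm_of_vanishing_axis {n : ℕ} (hf : SmoothNear f 0)
    (h : ∀ i < n, taylorCoeffAtZero f (i, 0) = 0) (hp : 0 < p) (hq : 0 < q) (hn : q ≤ p * n) :
    HasInitialForm f p q q (fun x => taylorCoeffAtZero f (0, 1) * x.2 +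
      (if q = p * n then taylorCoeffAtZero f (n, 0) else 0) * x.1 ^ n) := by
  obtain ⟨k, g, hk, hg, hfe, hk0, hg0⟩ := hf.exists_eventuallyEq_pow_mul_add h
  have hpow : HasInitialForm (fun x => x.1 ^ n * k x.1) p q (n * p + 0)
      (fun x => x.1 ^ n * k 0) :=
    ((HasInitialForm.fst q).pow n).mul
      (.of_continuousAt (f := fun x => k x.1) hp hq
        (hk.continuous.comp continuous_fst).continuousAt)
  have hoff : HasInitialForm (fun x => x.2 * g x) p q q (fun x => x.2 * g 0) :=
    (HasInitialForm.snd p).mul (.of_continuousAt hp hq hg.continuous.continuousAt)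
  have haxis : HasInitialForm (fun x => x.1 ^ n * k x.1) p q q
      (fun x => (if q = p * n then k 0 else 0) * x.1 ^ n) := by
    rw [add_zero, mul_comm n p] at hpow
    split_ifs with hqn
    · rw [← hqn] at hpow
      exact hpow.congr_right fun x => mul_comm _ _
    · exact (hpow.of_lt (lt_of_le_of_ne hn hqn)).congr_right fun x => (zero_mul _).symm
  refine ((haxis.add hoff).congr hp hq hfe).congr_right fun x => ?_
  rw [hk0, hg0]; ring

theorem HasInitialForm.comp_of_eventuallyEq_pow_mul {v P : ℝ × ℝ → ℝ} {l n : ℕ} {b β : ℝ → ℝ}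
    (hv : HasInitialForm v p q l P) (hp : 0 < p) (hq : 0 < q) (hv0 : ContinuousAt v 0)
    (hv00 : v 0 = 0) (hβ : ContinuousAt β 0) (hb : ∀ᶠ t in 𝓝 (0 : ℝ), b t = t ^ n * β t) :
    HasInitialForm (fun x => b (v x)) p q (n * l) (fun x => P x ^ n * β 0) := by
  have hβv : ContinuousAt (fun x => β (v x)) 0 :=
    ContinuousAt.comp (g := β) (f := v) (by rwa [hv00]) hv0
  have hmul := (hv.pow n).mul (.of_continuousAt hp hq hβv)
  rw [hv00] at hmul
  have hv0' : Tendsto v (𝓝 0) (𝓝 0) := by simpa [hv00] using hv0.tendsto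
  exact hmul.congr hp hq (hv0'.eventually hb)

end InitialForm

section NewtonDistance

variable {f : ℝ × ℝ → ℝ}

theorem mem_newtonPolyhedron_of_taylorCoeffAtZero_ne_zero {i j : ℕ}
    (h : taylorCoeffAtZero f (i, j) ≠ 0) (hij : 0 < i + j) :
    ((i : ℝ), (j : ℝ)) ∈ newtonPolyhedron f := by
  refine subset_convexHull ℝ _ (Set.mem_iUnion₂.2 ⟨(i, j), ⟨fun h0 => ?_, h⟩, le_rfl, le_rfl⟩)
  rw [Prod.mk.injEq] at h0
  omega

theorem newtonDist_le_max {i j : ℕ} (h : taylorCoeffAtZero f (i, j) ≠ 0) (hij : 0 < i + j) :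
    newtonDist f ≤ ENNReal.ofReal (max i j) :=
  iInf₂_le (max (i : ℝ) j) (newtonPolyhedron_upward f
    (mem_newtonPolyhedron_of_taylorCoeffAtZero_ne_zero h hij) (le_max_left _ _) (le_max_right _ _))

theorem newtonDist_le_of_weights {p q l i j i' j' : ℕ} (hpq : 0 < p + q)
    (h : taylorCoeffAtZero f (i, j) ≠ 0) (hl : p * i + q * j ≤ l) (hij : i ≤ j) (h0 : 0 < j)
    (h' : taylorCoeffAtZero f (i', j') ≠ 0) (hl' : p * i' + q * j' ≤ l) (hij' : j' ≤ i')
    (h0' : 0 < i') : newtonDist f ≤ ENNReal.ofReal (l / (p + q)) := by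
  have hpq' : (0 : ℝ) < p + q := by exact_mod_cast hpq
  have hmem := mem_newtonPolyhedron_of_taylorCoeffAtZero_ne_zero h (by omega)
  have hmem' := mem_newtonPolyhedron_of_taylorCoeffAtZero_ne_zero h' (by omega)
  have hlR : (p * i + q * j : ℝ) ≤ l := by exact_mod_cast hl
  have hlR' : (p * i' + q * j' : ℝ) ≤ l := by exact_mod_cast hl'
  have hijR : (0 : ℝ) ≤ j - i := sub_nonneg.2 (by exact_mod_cast hij)
  have hijR' : (0 : ℝ) ≤ i' - j' := sub_nonneg.2 (by exact_mod_cast hij')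
  obtain ⟨a, b, ha, hb, hab, hdiag⟩ : ∃ a b : ℝ, 0 ≤ a ∧ 0 ≤ b ∧ a + b = 1 ∧
      a * i + b * i' = a * j + b * j' := by
    rcases (add_nonneg hijR hijR').eq_or_lt with hsum | hsum
    · exact ⟨1, 0, zero_le_one, le_rfl, add_zero 1, by linarith⟩
    · refine ⟨(i' - j') / (j - i + (i' - j')), (j - i) / (j - i + (i' - j')), by positivity,
        by positivity, ?_, ?_⟩ <;> field_simp <;> ring
  have hle : a * i + b * i' ≤ l / (p + q) := by
    rw [le_div_iff₀ hpq']
    nlinarith [mul_le_mul_of_nonneg_left hlR ha, mul_le_mul_of_nonneg_left hlR' hb]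
  refine iInf₂_le ((l : ℝ) / (p + q)) (newtonPolyhedron_upward f
    (convex_convexHull ℝ _ hmem hmem' ha hb hab) ?_ ?_)
  · simpa using hle
  · simpa [← hdiag] using hle

theorem le_newtonDist_of_weights {p q l : ℕ} (hpq : 0 < p + q)
    (h : ∀ i j, 0 < i + j → p * i + q * j < l → taylorCoeffAtZero f (i, j) = 0) :
    ENNReal.ofReal (l / (p + q)) ≤ newtonDist f := by
  have hhalf : newtonPolyhedron f ⊆ {t : ℝ × ℝ | (l : ℝ) ≤ p * t.1 + q * t.2} := by
    refine convexHull_min (fun t ht => ?_) (convex_halfSpace_ge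
      (f := fun t : ℝ × ℝ => (p : ℝ) * t.1 + q * t.2) ⟨?_, ?_⟩ _)
    · simp only [Set.mem_iUnion, Set.mem_ofPred_eq] at ht ⊢
      obtain ⟨α, ⟨h0, hα⟩, h1, h2⟩ := ht
      have hαpos : 0 < α.1 + α.2 := by
        by_contra hα0
        exact h0 (Prod.ext (by simp; omega) (by simp; omega))
      have hl : (l : ℝ) ≤ p * α.1 + q * α.2 := by
        exact_mod_cast not_lt.1 fun hlt => hα (h α.1 α.2 hαpos hlt)
      exact hl.trans (by gcongr)
    · intro x y; simp; ring
    · intro c x; simp; ring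
  refine le_iInf₂ fun d hd => ENNReal.ofReal_le_ofReal ?_
  have hd' : (l : ℝ) ≤ p * d + q * d := hhalf hd
  rw [div_le_iff₀ (by exact_mod_cast hpq)]
  linarith

theorem newtonPolyhedron_subset_preimage_swap {g : ℝ × ℝ → ℝ}
    (h : ∀ i j, taylorCoeffAtZero g (i, j) = taylorCoeffAtZero f (j, i)) :
    newtonPolyhedron f ⊆ LinearEquiv.prodComm ℝ ℝ ℝ ⁻¹' newtonPolyhedron g := by
  refine convexHull_min (fun t ht => subset_convexHull ℝ _ ?_)
    ((convex_convexHull ℝ _).linear_preimage (LinearEquiv.prodComm ℝ ℝ ℝ).toLinearMap)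
  simp only [Set.mem_iUnion, Set.mem_ofPred_eq] at ht ⊢
  obtain ⟨⟨i, j⟩, ⟨h0, hα⟩, h1, h2⟩ := ht
  exact ⟨(j, i), ⟨fun hji => h0 (Prod.swap_injective hji), by rwa [h]⟩, h2, h1⟩

theorem SmoothNear.newtonDist_swap (hf : SmoothNear f 0) :
    newtonDist (fun x => f x.swap) = newtonDist f := by
  have h := newtonPolyhedron_subset_preimage_swap hf.taylorCoeffAtZero_swap
  have h' := newtonPolyhedron_subset_preimage_swap fun i j => (hf.taylorCoeffAtZero_swap j i).symm
  exact le_antisymm (le_iInf₂ fun d hd => iInf₂_le d (h hd))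
    (le_iInf₂ fun d hd => iInf₂_le d (h' hd))

theorem newtonDist_le_three_halves
    (h : taylorCoeffAtZero f (3, 0) ≠ 0 ∨ taylorCoeffAtZero f (2, 1) ≠ 0)
    (h' : taylorCoeffAtZero f (0, 3) ≠ 0 ∨ taylorCoeffAtZero f (1, 2) ≠ 0) :
    newtonDist f ≤ ENNReal.ofReal (3 / 2) := by
  rw [show (3 / 2 : ℝ) = (3 : ℕ) / ((1 : ℕ) + (1 : ℕ)) by norm_num]
  rcases h with h | h <;> rcases h' with h' | h' <;>
    exact newtonDist_le_of_weights two_pos h' (by norm_num) (by norm_num) (by norm_num)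
      h (by norm_num) (by norm_num) (by norm_num)

end NewtonDistance

theorem two_mul_div_add_one_le {l n : ℕ} (hln : l ≤ n) :
    (2 * l / (l + 1) : ℝ) ≤ 2 * n / (n + 1) := by
  have : (l : ℝ) ≤ n := by exact_mod_cast hln
  rw [div_le_div_iff₀ (by positivity) (by positivity)]
  linarith

theorem three_halves_le_two_mul_div {n : ℕ} (hn : 4 ≤ n) : (3 / 2 : ℝ) ≤ 2 * n / (n + 1) :=
  le_trans (by norm_num) (two_mul_div_add_one_le hn)

theorem two_mul_div_two_add_pred {n : ℕ} (hn : 1 ≤ n) :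
    (2 * n : ℕ) / ((2 : ℕ) + (n - 1 : ℕ)) = (2 * n / (n + 1) : ℝ) := by
  push_cast [Nat.cast_sub hn]
  ring

/-- `g = B U² + Vⁿ R` near the origin, where `(U, V)` are local coordinates and the linear part of
`B` is a nonzero multiple of that of `V`. This is the shape of a singularity of type `D` in
arbitrary coordinates; the factor `R` is not required to be nonzero at the origin, so that functions
vanishing to infinite order may be absorbed in `Vⁿ R` for every `n`. -/
structure IsTypeDForm (g B U V R : ℝ × ℝ → ℝ) (n : ℕ) : Prop where
  eventuallyEq : g =ᶠ[𝓝 0] fun x => B x * U x ^ 2 + V x ^ n * R x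
  smooth_B : SmoothNear B 0
  smooth_U : SmoothNear U 0
  smooth_V : SmoothNear V 0
  smooth_R : SmoothNear R 0
  B_zero : B 0 = 0
  U_zero : U 0 = 0
  V_zero : V 0 = 0
  linear_B : ∃ a : ℝ, a ≠ 0 ∧ taylorCoeffAtZero B (1, 0) = a * taylorCoeffAtZero V (1, 0) ∧
    taylorCoeffAtZero B (0, 1) = a * taylorCoeffAtZero V (0, 1)
  det_ne_zero : taylorCoeffAtZero V (1, 0) * taylorCoeffAtZero U (0, 1) -
    taylorCoeffAtZero V (0, 1) * taylorCoeffAtZero U (1, 0) ≠ 0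

namespace IsTypeDForm

variable {g B U V R : ℝ × ℝ → ℝ} {n : ℕ}

theorem smoothNear (h : IsTypeDForm g B U V R n) : SmoothNear g 0 :=
  ((h.smooth_B.mul (h.smooth_U.pow 2)).add ((h.smooth_V.pow n).mul h.smooth_R)).congr
    h.eventuallyEq

theorem of_le {l : ℕ} (h : IsTypeDForm g B U V R n) (hl : l ≤ n) :
    IsTypeDForm g B U V (fun x => V x ^ (n - l) * R x) l where
  __ := h
  eventuallyEq := h.eventuallyEq.trans (.of_forall fun x => by
    beta_reduce
    rw [← mul_assoc, ← pow_add, Nat.add_sub_cancel' hl])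
  smooth_R := (h.smooth_V.pow _).mul h.smooth_R

theorem swap (h : IsTypeDForm g B U V R n) :
    IsTypeDForm (fun x => g x.swap) (fun x => B x.swap) (fun x => U x.swap) (fun x => V x.swap)
      (fun x => R x.swap) n where
  eventuallyEq := (continuous_swap.tendsto (0 : ℝ × ℝ)).eventually h.eventuallyEq
  smooth_B := h.smooth_B.comp_swap
  smooth_U := h.smooth_U.comp_swap
  smooth_V := h.smooth_V.comp_swap
  smooth_R := h.smooth_R.comp_swap
  B_zero := h.B_zero
  U_zero := h.U_zero
  V_zero := h.V_zero
  linear_B := by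
    obtain ⟨a, ha, h1, h2⟩ := h.linear_B
    simp only [h.smooth_B.taylorCoeffAtZero_swap, h.smooth_V.taylorCoeffAtZero_swap]
    exact ⟨a, ha, h2, h1⟩
  det_ne_zero := by
    simp only [h.smooth_U.taylorCoeffAtZero_swap, h.smooth_V.taylorCoeffAtZero_swap]
    exact fun h' => h.det_ne_zero (by linarith)

theorem hasInitialForm_cubic (h : IsTypeDForm g B U V R n) (hn : 4 ≤ n) :
    HasInitialForm g 1 1 3 fun x =>
      (taylorCoeffAtZero B (1, 0) * x.1 + taylorCoeffAtZero B (0, 1) * x.2) *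
        (taylorCoeffAtZero U (1, 0) * x.1 + taylorCoeffAtZero U (0, 1) * x.2) ^ 2 := by
  have hBU := (h.smooth_B.hasInitialForm_linear h.B_zero).mul
    ((h.smooth_U.hasInitialForm_linear h.U_zero).pow 2)
  have hVR := (((h.smooth_V.hasInitialForm_linear h.V_zero).pow n).mul
    (.of_continuousAt one_pos one_pos h.smooth_R.continuousAt)).of_lt (l := 3) (by omega)
  exact ((hBU.add hVR).congr one_pos one_pos h.eventuallyEq).congr_right fun x => add_zero _

theorem taylorCoeffAtZero_cubic {b₁ b₂ r s : ℝ} (h : IsTypeDForm g B U V R n) (hn : 4 ≤ n)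
    (hb₁ : taylorCoeffAtZero B (1, 0) = b₁) (hb₂ : taylorCoeffAtZero B (0, 1) = b₂)
    (hr : taylorCoeffAtZero U (1, 0) = r) (hs : taylorCoeffAtZero U (0, 1) = s) :
    taylorCoeffAtZero g (3, 0) = b₁ * r ^ 2 ∧
    taylorCoeffAtZero g (2, 1) = 2 * b₁ * r * s + b₂ * r ^ 2 ∧
    taylorCoeffAtZero g (1, 2) = b₁ * s ^ 2 + 2 * b₂ * r * s ∧
    taylorCoeffAtZero g (0, 3) = b₂ * s ^ 2 := by
  have hcubic := h.hasInitialForm_cubic hn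
  rw [hb₁, hb₂, hr, hs] at hcubic
  have hcoeff {i j : ℕ} (hij : 1 * i + 1 * j = 3) := hcubic.taylorCoeffAtZero_eq h.smoothNear
    one_pos one_pos (Q := .C (b₁ * r ^ 2) * .X ^ 3 + .C (2 * b₁ * r * s + b₂ * r ^ 2) * .X ^ 2 +
      .C (b₁ * s ^ 2 + 2 * b₂ * r * s) * .X ^ 1 + .C (b₂ * s ^ 2) * .X ^ 0)
    (fun t => by simp; ring) hij
  refine ⟨?_, ?_, ?_, ?_⟩ <;> rw [hcoeff (by norm_num)] <;>
    simp only [Polynomial.coeff_add, Polynomial.coeff_C_mul, Polynomial.coeff_X_pow] <;> norm_num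

theorem newtonDist_le_three_halves (h : IsTypeDForm g B U V R n) (hn : 4 ≤ n)
    (hr : taylorCoeffAtZero U (1, 0) ≠ 0) (hs : taylorCoeffAtZero U (0, 1) ≠ 0) :
    newtonDist g ≤ ENNReal.ofReal (3 / 2) := by
  obtain ⟨h30, h21, h12, h03⟩ := h.taylorCoeffAtZero_cubic hn rfl rfl rfl rfl
  have hB : taylorCoeffAtZero B (1, 0) ≠ 0 ∨ taylorCoeffAtZero B (0, 1) ≠ 0 := by
    obtain ⟨a, ha, h1, h2⟩ := h.linear_B
    by_contra! hB
    rw [h1, h2] at hB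
    refine h.det_ne_zero ?_
    rw [(mul_eq_zero.1 hB.1).resolve_left ha, (mul_eq_zero.1 hB.2).resolve_left ha]
    ring
  refine _root_.newtonDist_le_three_halves ?_ ?_
  · rw [h30, h21]
    rcases eq_or_ne (taylorCoeffAtZero B (1, 0)) 0 with h0 | h0
    · right; simpa [h0, hr] using hB
    · left; positivity
  · rw [h03, h12]
    rcases eq_or_ne (taylorCoeffAtZero B (0, 1)) 0 with h0 | h0
    · right; simpa [h0, hs] using hB
    · left; positivity

theorem ne_zero_of_axis (h : IsTypeDForm g B U V R n) (hr : taylorCoeffAtZero U (1, 0) = 0) :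
    taylorCoeffAtZero B (1, 0) ≠ 0 ∧ taylorCoeffAtZero V (1, 0) ≠ 0 ∧
      taylorCoeffAtZero U (0, 1) ≠ 0 := by
  obtain ⟨a, ha, h1, -⟩ := h.linear_B
  have hdet := h.det_ne_zero
  rw [hr, mul_zero, sub_zero] at hdet
  have hV := left_ne_zero_of_mul hdet
  exact ⟨h1 ▸ mul_ne_zero ha hV, hV, right_ne_zero_of_mul hdet⟩

theorem newtonDist_le_two_of_axis (h : IsTypeDForm g B U V R n) (hn : 4 ≤ n)
    (hr : taylorCoeffAtZero U (1, 0) = 0) : newtonDist g ≤ ENNReal.ofReal 2 := by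
  obtain ⟨hB, -, hs⟩ := h.ne_zero_of_axis hr
  obtain ⟨-, -, h12, -⟩ := h.taylorCoeffAtZero_cubic hn rfl rfl hr rfl
  have h12' : taylorCoeffAtZero g (1, 2) ≠ 0 := by
    rw [h12, mul_zero, zero_mul, add_zero]
    positivity
  simpa using newtonDist_le_max h12' (by norm_num)

/-- The weights `(2, n - 1)` are those of the edge from `(1, 2)` to `(n, 0)`. -/
theorem hasInitialForm_of_vanishing_axis (h : IsTypeDForm g B U V R n) (hn : 4 ≤ n)
    (hU : ∀ i < n / 2, taylorCoeffAtZero U (i, 0) = 0) :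
    HasInitialForm g 2 (n - 1) (2 * n) fun x =>
      taylorCoeffAtZero B (1, 0) * x.1 * (taylorCoeffAtZero U (0, 1) * x.2 +
        (if n - 1 = 2 * (n / 2) then taylorCoeffAtZero U (n / 2, 0) else 0) * x.1 ^ (n / 2)) ^ 2 +
      taylorCoeffAtZero V (1, 0) ^ n * R 0 * x.1 ^ n := by
  have hq : 0 < n - 1 := by omega
  have hB := h.smooth_B.hasInitialForm_fst h.B_zero two_pos (q := n - 1) (by omega)
  have hV := h.smooth_V.hasInitialForm_fst h.V_zero two_pos (q := n - 1) (by omega)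
  have hBU := hB.mul ((h.smooth_U.hasInitialForm_of_vanishing_axis hU two_pos hq (by omega)).pow 2)
  have hVR := (hV.pow n).mul (.of_continuousAt two_pos hq h.smooth_R.continuousAt)
  rw [show 2 + 2 * (n - 1) = 2 * n by omega] at hBU
  rw [show n * 2 + 0 = 2 * n by omega] at hVR
  exact ((hBU.add hVR).congr two_pos hq h.eventuallyEq).congr_right fun x => by ring

theorem le_newtonDist (h : IsTypeDForm g B U V R n) (hn : 4 ≤ n)
    (hU : ∀ i < n / 2, taylorCoeffAtZero U (i, 0) = 0) :
    ENNReal.ofReal (2 * n / (n + 1)) ≤ newtonDist g := by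
  have hle := le_newtonDist_of_weights (f := g) (p := 2) (q := n - 1) (l := 2 * n) (by omega)
    fun i j _ hij => (h.hasInitialForm_of_vanishing_axis hn hU).taylorCoeffAtZero_eq_zero
      h.smoothNear two_pos (by omega) hij
  rwa [two_mul_div_two_add_pred (by omega)] at hle

theorem newtonDist_le_of_vanishing_axis (h : IsTypeDForm g B U V R n) (hn : 4 ≤ n)
    (hU : ∀ i < n / 2, taylorCoeffAtZero U (i, 0) = 0)
    (hne : (n - 1 = 2 * (n / 2) ∧ taylorCoeffAtZero U (n / 2, 0) ≠ 0) ∨ R 0 ≠ 0) :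
    newtonDist g ≤ ENNReal.ofReal (2 * n / (n + 1)) := by
  obtain ⟨hB, hV, hs⟩ := h.ne_zero_of_axis (hU 1 (by omega))
  have hform := h.hasInitialForm_of_vanishing_axis hn hU
  set b := taylorCoeffAtZero B (1, 0)
  set s := taylorCoeffAtZero U (0, 1)
  set δ := if n - 1 = 2 * (n / 2) then taylorCoeffAtZero U (n / 2, 0) else 0 with hδ
  set γ := taylorCoeffAtZero V (1, 0) ^ n * R 0 with hγ
  have hcoeff {i j : ℕ} (hij : 2 * i + (n - 1) * j = 2 * n) : taylorCoeffAtZero g (i, j) =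
      b * s ^ 2 * (if i = 1 then 1 else 0) + 2 * b * s * δ * (if i = n / 2 + 1 then 1 else 0) +
        b * δ ^ 2 * (if i = 2 * (n / 2) + 1 then 1 else 0) + γ * (if i = n then 1 else 0) := by
    rw [hform.taylorCoeffAtZero_eq h.smoothNear two_pos (by omega)
      (Q := .C (b * s ^ 2) * .X ^ 1 + .C (2 * b * s * δ) * .X ^ (n / 2 + 1) +
        .C (b * δ ^ 2) * .X ^ (2 * (n / 2) + 1) + .C γ * .X ^ n) (fun t => by simp; ring) hij]
    simp only [Polynomial.coeff_add, Polynomial.coeff_C_mul, Polynomial.coeff_X_pow]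
  have h12 : taylorCoeffAtZero g (1, 2) ≠ 0 := by
    rw [hcoeff (by omega), if_pos rfl, if_neg (by omega), if_neg (by omega), if_neg (by omega)]
    simp [hB, hs]
  obtain ⟨i, j, hij, hji, hi, hne'⟩ : ∃ i j, 2 * i + (n - 1) * j = 2 * n ∧ j ≤ i ∧ 0 < i ∧
      taylorCoeffAtZero g (i, j) ≠ 0 := by
    by_cases hδ0 : δ = 0
    · have hR : R 0 ≠ 0 := hne.resolve_left fun ⟨hodd, hδ'⟩ => hδ' (by rwa [hδ, if_pos hodd] at hδ0)
      refine ⟨n, 0, by omega, by omega, by omega, ?_⟩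
      rw [hcoeff (by omega), hδ0, if_pos rfl, if_neg (by omega : n ≠ 1)]
      simp [hγ, hV, hR]
    · have hodd : n - 1 = 2 * (n / 2) := not_not.1 fun hodd => hδ0 (by rw [hδ, if_neg hodd])
      refine ⟨n / 2 + 1, 1, by omega, by omega, by omega, ?_⟩
      rw [hcoeff (by omega), if_pos rfl, if_neg (by omega), if_neg (by omega), if_neg (by omega)]
      simp [hB, hs, hδ0]
  have hle := newtonDist_le_of_weights (p := 2) (q := n - 1) (l := 2 * n) (by omega) h12 (by omega)
    (by norm_num) (by norm_num) hne' hij.le hji hi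
  rwa [two_mul_div_two_add_pred (by omega)] at hle

theorem newtonDist_le_of_axis (h : IsTypeDForm g B U V R n) (hn : 4 ≤ n) (hR : R 0 ≠ 0)
    (hr : taylorCoeffAtZero U (1, 0) = 0) : newtonDist g ≤ ENNReal.ofReal (2 * n / (n + 1)) := by
  classical
  by_cases! hU : ∀ i < n / 2, taylorCoeffAtZero U (i, 0) = 0
  · exact h.newtonDist_le_of_vanishing_axis hn hU (.inr hR)
  have hex : ∃ i, taylorCoeffAtZero U (i, 0) ≠ 0 := hU.imp fun i hi => hi.2
  obtain ⟨j, hj, hmin⟩ : ∃ j, taylorCoeffAtZero U (j, 0) ≠ 0 ∧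
      ∀ i < j, taylorCoeffAtZero U (i, 0) = 0 :=
    ⟨Nat.find hex, Nat.find_spec hex, fun i hi => not_not.1 (Nat.find_min hex hi)⟩
  have hjn : j < n / 2 := by
    obtain ⟨i, hi, hi'⟩ := hU
    exact (not_lt.1 fun hij => hi' (hmin i hij)).trans_lt hi
  have hj2 : 2 ≤ j := by
    by_contra! hlt
    interval_cases j
    · exact hj (by rw [taylorCoeffAtZero_zero_zero, h.U_zero])
    · exact hj hr
  have hdiv : (2 * j + 1) / 2 = j := by omega
  exact ((h.of_le (l := 2 * j + 1) (by omega)).newtonDist_le_of_vanishing_axis (by omega)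
    (by rwa [hdiv]) (.inl (by rw [hdiv]; exact ⟨rfl, hj⟩))).trans
    (ENNReal.ofReal_le_ofReal (two_mul_div_add_one_le (by omega)))

/-- If the linear part of `U` vanishes on neither axis, the cubic part bounds the Newton distance by
`3 / 2`. -/
theorem newtonDist_le_of_cases {D : ℝ} (h : IsTypeDForm g B U V R n) (hn : 4 ≤ n) (hD : 3 / 2 ≤ D)
    (h1 : taylorCoeffAtZero U (1, 0) = 0 → newtonDist g ≤ ENNReal.ofReal D)
    (h2 : taylorCoeffAtZero (fun x => U x.swap) (1, 0) = 0 →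
      newtonDist (fun x => g x.swap) ≤ ENNReal.ofReal D) :
    newtonDist g ≤ ENNReal.ofReal D := by
  by_cases hr : taylorCoeffAtZero U (1, 0) = 0
  · exact h1 hr
  by_cases hs : taylorCoeffAtZero U (0, 1) = 0
  · rw [← h.smoothNear.newtonDist_swap]
    exact h2 (by rw [h.smooth_U.taylorCoeffAtZero_swap, hs])
  · exact (h.newtonDist_le_three_halves hn hr hs).trans (ENNReal.ofReal_le_ofReal hD)

theorem newtonDist_le (h : IsTypeDForm g B U V R n) (hn : 4 ≤ n) (hR : R 0 ≠ 0) :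
    newtonDist g ≤ ENNReal.ofReal (2 * n / (n + 1)) :=
  h.newtonDist_le_of_cases hn (three_halves_le_two_mul_div hn) (h.newtonDist_le_of_axis hn hR)
    (h.swap.newtonDist_le_of_axis hn hR)

theorem newtonDist_le_two (h : IsTypeDForm g B U V R n) (hn : 4 ≤ n) :
    newtonDist g ≤ ENNReal.ofReal 2 :=
  h.newtonDist_le_of_cases hn (by norm_num) (h.newtonDist_le_two_of_axis hn)
    (h.swap.newtonDist_le_two_of_axis hn)

end IsTypeDForm

section LinearPart

variable {f : ℝ × ℝ → ℝ}

theorem SmoothNear.taylorCoeffAtZero_one_zero (hf : SmoothNear f 0) :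
    taylorCoeffAtZero f (1, 0) = fderiv ℝ f 0 (1, 0) := by
  rw [taylorCoeffAtZero_fst, iteratedDeriv_one, Nat.factorial_one, Nat.cast_one, div_one]
  exact (hf.differentiableAt.hasFDerivAt.comp_hasDerivAt_of_eq (0 : ℝ)
    ((hasDerivAt_id (0 : ℝ)).prodMk (hasDerivAt_const (0 : ℝ) (0 : ℝ))) rfl).deriv

theorem SmoothNear.taylorCoeffAtZero_zero_one (hf : SmoothNear f 0) :
    taylorCoeffAtZero f (0, 1) = fderiv ℝ f 0 (0, 1) := by
  simp only [taylorCoeffAtZero, partialAtZero, iteratedDeriv_zero, iteratedDeriv_one,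
    Nat.factorial, Nat.cast_one, mul_one, div_one, one_mul]
  exact (hf.differentiableAt.hasFDerivAt.comp_hasDerivAt_of_eq (0 : ℝ)
    ((hasDerivAt_const (0 : ℝ) (0 : ℝ)).prodMk (hasDerivAt_id (0 : ℝ))) rfl).deriv

theorem map_eq_fst_smul_add_snd_smul {E : Type*} [AddCommGroup E] [Module ℝ E]
    [TopologicalSpace E] (A : ℝ × ℝ →L[ℝ] E) (v : ℝ × ℝ) :
    A v = v.1 • A (1, 0) + v.2 • A (0, 1) := by
  rw [← map_smul, ← map_smul, ← map_add]
  simp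

theorem SmoothNear.fderiv_apply (hf : SmoothNear f 0) (v : ℝ × ℝ) :
    fderiv ℝ f 0 v = taylorCoeffAtZero f (1, 0) * v.1 + taylorCoeffAtZero f (0, 1) * v.2 := by
  rw [map_eq_fst_smul_add_snd_smul, hf.taylorCoeffAtZero_one_zero, hf.taylorCoeffAtZero_zero_one,
    smul_eq_mul, smul_eq_mul, mul_comm, mul_comm v.2]

theorem det_ne_zero_of_injective {A : ℝ × ℝ →L[ℝ] ℝ × ℝ} (hA : Function.Injective A) :
    (A (1, 0)).1 * (A (0, 1)).2 - (A (0, 1)).1 * (A (1, 0)).2 ≠ 0 := by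
  intro hdet
  have hker (v : ℝ × ℝ) (h1 : v.1 * (A (1, 0)).1 + v.2 * (A (0, 1)).1 = 0)
      (h2 : v.1 * (A (1, 0)).2 + v.2 * (A (0, 1)).2 = 0) : v = 0 := by
    refine hA ?_
    rw [map_zero, map_eq_fst_smul_add_snd_smul]
    exact Prod.ext h1 h2
  have hrow₁ := hker ((A (0, 1)).1, -(A (1, 0)).1) (by ring) (by linarith)
  have hrow₂ := hker ((A (0, 1)).2, -(A (1, 0)).2) (by linarith) (by ring)
  simp only [Prod.mk_eq_zero, neg_eq_zero] at hrow₁ hrow₂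
  simpa using hker (1, 0) (by simp [hrow₁]) (by simp [hrow₂])

theorem taylorCoeffAtZero_of_axis_eventuallyEq {n : ℕ} {k : ℝ → ℝ} (hk : SmoothNear k 0)
    (h : ∀ᶠ t in 𝓝 (0 : ℝ), f (t, 0) = t ^ n * k t) :
    (∀ i < n, taylorCoeffAtZero f (i, 0) = 0) ∧ taylorCoeffAtZero f (n, 0) = k 0 := by
  set F : ℝ × ℝ → ℝ := fun x => x.1 ^ n * k x.1
  have hcoeff (i : ℕ) : taylorCoeffAtZero f (i, 0) = taylorCoeffAtZero F (i, 0) := by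
    rw [taylorCoeffAtZero_fst, taylorCoeffAtZero_fst,
      EventuallyEq.iteratedDeriv_eq i (g := fun s => F (s, 0)) h]
  have hfst : SmoothNear (fun x : ℝ × ℝ => x.1) 0 := .of_contDiff contDiff_fst 0
  have hks : SmoothNear (fun x : ℝ × ℝ => k x.1) 0 := SmoothNear.comp (f := k) hk hfst
  have hFs : SmoothNear F 0 := (hfst.pow n).mul hks
  have hform : HasInitialForm F 1 1 n fun x => x.1 ^ n * k 0 := by
    have hprod := ((HasInitialForm.fst 1).pow n).mul
      (.of_continuousAt one_pos one_pos hks.continuousAt)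
    rwa [mul_one, add_zero] at hprod
  refine ⟨fun i hi => ?_, ?_⟩
  · rw [hcoeff, hform.taylorCoeffAtZero_eq_zero hFs one_pos one_pos (by omega)]
  · rw [hcoeff, hform.taylorCoeffAtZero_eq hFs one_pos one_pos
      (Q := .monomial n (k 0)) (fun t => by simpa using mul_comm _ _) (by ring)]
    simp

end LinearPart

section Height

theorem isLocalCoordinateChange_continuousLinearEquiv (L : (ℝ × ℝ) ≃L[ℝ] (ℝ × ℝ)) :
    IsLocalCoordinateChange L :=
  ⟨.of_contDiff L.contDiff 0, map_zero L, L, L.fderiv.symm⟩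

theorem IsLocalCoordinateChange.continuousLinearEquiv_comp {Ψ : ℝ × ℝ → ℝ × ℝ}
    (h : IsLocalCoordinateChange Ψ) (L : (ℝ × ℝ) ≃L[ℝ] (ℝ × ℝ)) :
    IsLocalCoordinateChange (L ∘ Ψ) := by
  obtain ⟨hΨ, hΨ0, A, hA⟩ := h
  exact ⟨SmoothNear.comp (f := L) (.of_contDiff L.contDiff _) hΨ, by simp [hΨ0], A.trans L, by
    rw [L.comp_fderiv, ← hA]; rfl⟩

theorem IsLocalCoordinateChange.det_ne_zero {X : ℝ × ℝ → ℝ × ℝ} (hX : IsLocalCoordinateChange X) :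
    (fderiv ℝ X 0 (1, 0)).1 * (fderiv ℝ X 0 (0, 1)).2 -
      (fderiv ℝ X 0 (0, 1)).1 * (fderiv ℝ X 0 (1, 0)).2 ≠ 0 := by
  obtain ⟨-, -, A, hA⟩ := hX
  exact det_ne_zero_of_injective (by rw [← hA]; exact A.injective)

variable (φ : ℝ × ℝ → ℝ) (L : (ℝ × ℝ) ≃L[ℝ] (ℝ × ℝ))

theorem height_comp_continuousLinearEquiv : height (φ ∘ L) = height φ := by
  have hle (ψ : ℝ × ℝ → ℝ) (L : (ℝ × ℝ) ≃L[ℝ] (ℝ × ℝ)) : height (ψ ∘ L) ≤ height ψ :=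
    iSup₂_le fun Ψ hΨ => le_iSup₂_of_le (L ∘ Ψ) (hΨ.continuousLinearEquiv_comp L) le_rfl
  refine (hle φ L).antisymm ?_
  simpa [Function.comp_assoc] using hle (φ ∘ L) L.symm

theorem linHeight_comp_continuousLinearEquiv : linHeight (φ ∘ L) = linHeight φ := by
  have hle (ψ : ℝ × ℝ → ℝ) (L : (ℝ × ℝ) ≃L[ℝ] (ℝ × ℝ)) : linHeight (ψ ∘ L) ≤ linHeight ψ :=
    iSup_le fun L' => le_iSup_of_le (L'.trans L) le_rfl
  refine (hle φ L).antisymm ?_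
  simpa [Function.comp_assoc] using hle (φ ∘ L) L.symm

theorem newtonDist_le_linHeight : newtonDist φ ≤ linHeight φ :=
  le_iSup_of_le (ContinuousLinearEquiv.refl ℝ (ℝ × ℝ)) le_rfl

end Height

/-- `F = b (x₂ - ψ(x₁))² + b₀(x₁)` near the origin, where `b` has linear part a nonzero multiple of
`x₁` and `ψ` vanishes to second order. The type `D` normal forms are those for which moreover the
orders of vanishing of `ψ` and `b₀` are prescribed. -/
structure IsPrenormalForm (F b : ℝ × ℝ → ℝ) (ψ b₀ : ℝ → ℝ) : Prop where
  eventuallyEq : F =ᶠ[𝓝 0] fun x => b x * (x.2 - ψ x.1) ^ 2 + b₀ x.1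
  smooth_b : SmoothNear b 0
  smooth_ψ : SmoothNear ψ 0
  smooth_b₀ : SmoothNear b₀ 0
  b_zero : b 0 = 0
  b_one_zero : taylorCoeffAtZero b (1, 0) ≠ 0
  b_zero_one : taylorCoeffAtZero b (0, 1) = 0
  ψ_zero : ψ 0 = 0
  deriv_ψ_zero : deriv ψ 0 = 0

namespace IsPrenormalForm

variable {F b : ℝ × ℝ → ℝ} {ψ b₀ w β : ℝ → ℝ} {m n : ℕ}

theorem hasFDerivAt_ψ_comp_fst (h : IsPrenormalForm F b ψ b₀) {X : ℝ × ℝ → ℝ × ℝ}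
    (hX : SmoothNear X 0) (hX0 : X 0 = 0) :
    HasFDerivAt (fun x => ψ (X x).1) (0 : ℝ × ℝ →L[ℝ] ℝ) 0 := by
  have hψ : HasDerivAt ψ 0 0 :=
    h.smooth_ψ.differentiableAt.hasDerivAt.congr_deriv h.deriv_ψ_zero
  exact (hψ.comp_hasFDerivAt_of_eq 0 hX.fst.differentiableAt.hasFDerivAt
    (by simp [hX0])).congr_fderiv (zero_smul ℝ _)

theorem hasFDerivAt_snd_sub_ψ (h : IsPrenormalForm F b ψ b₀) {X : ℝ × ℝ → ℝ × ℝ}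
    (hX : SmoothNear X 0) (hX0 : X 0 = 0) :
    HasFDerivAt (fun x => (X x).2 - ψ (X x).1)
      ((ContinuousLinearMap.snd ℝ ℝ ℝ).comp (fderiv ℝ X 0)) 0 :=
  (hX.differentiableAt.hasFDerivAt.snd.sub (h.hasFDerivAt_ψ_comp_fst hX hX0)).congr_fderiv
    (sub_zero _)

theorem comp (h : IsPrenormalForm F b ψ b₀) {X : ℝ × ℝ → ℝ × ℝ}
    (hX : IsLocalCoordinateChange X) (hβ : SmoothNear β 0)
    (hb₀ : b₀ =ᶠ[𝓝 0] fun t => t ^ n * β t) :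
    IsTypeDForm (F ∘ X) (b ∘ X) (fun x => (X x).2 - ψ (X x).1) (fun x => (X x).1)
      (fun x => β (X x).1) n := by
  have hdet := hX.det_ne_zero
  obtain ⟨hXs, hX0, -⟩ := hX
  have hsmooth {k : ℝ → ℝ} (hk : SmoothNear k 0) : SmoothNear (fun x => k (X x).1) 0 :=
    SmoothNear.comp (f := k) (by simpa [hX0] using hk) hXs.fst
  have hB : SmoothNear (b ∘ X) 0 :=
    SmoothNear.comp (f := b) (u := X) (by simpa [hX0] using h.smooth_b) hXs
  have hU : SmoothNear (fun x => (X x).2 - ψ (X x).1) 0 := hXs.snd.sub (hsmooth h.smooth_ψ)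
  have hdX := hXs.differentiableAt.hasFDerivAt
  have hdU (v : ℝ × ℝ) : fderiv ℝ (fun x => (X x).2 - ψ (X x).1) 0 v = (fderiv ℝ X 0 v).2 := by
    simp [(h.hasFDerivAt_snd_sub_ψ hXs hX0).fderiv]
  have hdV (v : ℝ × ℝ) : fderiv ℝ (fun x => (X x).1) 0 v = (fderiv ℝ X 0 v).1 := by
    simp [hdX.fst.fderiv]
  have hdB (v : ℝ × ℝ) : fderiv ℝ (b ∘ X) 0 v =
      taylorCoeffAtZero b (1, 0) * (fderiv ℝ X 0 v).1 := by
    rw [fderiv_comp 0 (by simpa [hX0] using h.smooth_b.differentiableAt) hXs.differentiableAt, hX0,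
      ContinuousLinearMap.comp_apply, h.smooth_b.fderiv_apply, h.b_zero_one, zero_mul, add_zero]
  have hX0' : Tendsto X (𝓝 0) (𝓝 0) := by simpa [hX0] using hXs.continuousAt.tendsto
  have hfst : Tendsto (fun x => (X x).1) (𝓝 0) (𝓝 0) := by
    simpa [hX0] using hXs.fst.continuousAt.tendsto
  refine ⟨?_, hB, hU, hXs.fst, hsmooth hβ, by simp [hX0, h.b_zero], by simp [hX0, h.ψ_zero],
    by simp [hX0], ⟨_, h.b_one_zero, ?_, ?_⟩, ?_⟩
  · filter_upwards [hX0'.eventually h.eventuallyEq, hfst.eventually hb₀] with x hF hb₀x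
    simp only [Function.comp_apply, hF, hb₀x]
  · rw [hB.taylorCoeffAtZero_one_zero, hXs.fst.taylorCoeffAtZero_one_zero, hdB, hdV]
  · rw [hB.taylorCoeffAtZero_zero_one, hXs.fst.taylorCoeffAtZero_zero_one, hdB, hdV]
  · rw [hU.taylorCoeffAtZero_one_zero, hU.taylorCoeffAtZero_zero_one,
      hXs.fst.taylorCoeffAtZero_one_zero, hXs.fst.taylorCoeffAtZero_zero_one, hdU, hdU, hdV, hdV]
    exact hdet

theorem isLocalCoordinateChange_shear (h : IsPrenormalForm F b ψ b₀) :
    IsLocalCoordinateChange fun x : ℝ × ℝ => (x.1, x.2 + ψ x.1) := by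
  have hfst : SmoothNear (fun x : ℝ × ℝ => x.1) 0 := .of_contDiff contDiff_fst 0
  have hsnd : SmoothNear (fun x : ℝ × ℝ => x.2) 0 := .of_contDiff contDiff_snd 0
  refine ⟨hfst.prodMk (hsnd.add (SmoothNear.comp (f := ψ) h.smooth_ψ hfst)), by simp [h.ψ_zero],
    .refl ℝ _, ?_⟩
  have hψ := h.hasFDerivAt_ψ_comp_fst (.of_contDiff contDiff_id 0) rfl
  have hshear : HasFDerivAt (fun x : ℝ × ℝ => (x.1, x.2 + ψ x.1)) _ 0 :=
    hasFDerivAt_fst.prodMk (hasFDerivAt_snd.add hψ)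
  rw [hshear.fderiv]
  ext <;> simp

theorem height_le (h : IsPrenormalForm F b ψ b₀) (hn : 4 ≤ n) (hβ : SmoothNear β 0) (hβ0 : β 0 ≠ 0)
    (hb₀ : b₀ =ᶠ[𝓝 0] fun t => t ^ n * β t) : height F ≤ ENNReal.ofReal (2 * n / (n + 1)) :=
  iSup₂_le fun X hX => (h.comp hX hβ hb₀).newtonDist_le hn (by simpa [hX.2.1])

theorem height_le_two (h : IsPrenormalForm F b ψ b₀) (hn : 4 ≤ n) (hβ : SmoothNear β 0)
    (hb₀ : b₀ =ᶠ[𝓝 0] fun t => t ^ n * β t) : height F ≤ 2 :=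
  iSup₂_le fun _ hX => ((h.comp hX hβ hb₀).newtonDist_le_two hn).trans_eq (ENNReal.ofReal_ofNat 2)

theorem le_height (h : IsPrenormalForm F b ψ b₀) (hn : 4 ≤ n) (hβ : SmoothNear β 0)
    (hb₀ : b₀ =ᶠ[𝓝 0] fun t => t ^ n * β t) : ENNReal.ofReal (2 * n / (n + 1)) ≤ height F := by
  have hX := h.isLocalCoordinateChange_shear
  refine ((h.comp hX hβ hb₀).le_newtonDist hn
    (taylorCoeffAtZero_of_axis_eventuallyEq (k := 0) (.of_contDiff contDiff_const 0) ?_).1).trans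
    (le_iSup₂_of_le _ hX le_rfl)
  simp

theorem le_linHeight (h : IsPrenormalForm F b ψ b₀) (hn : 4 ≤ n) (hnm : n ≤ 2 * m + 1)
    (hw : SmoothNear w 0) (hψ : ψ =ᶠ[𝓝 0] fun t => t ^ m * w t) (hβ : SmoothNear β 0)
    (hb₀ : b₀ =ᶠ[𝓝 0] fun t => t ^ n * β t) :
    ENNReal.ofReal (2 * n / (n + 1)) ≤ linHeight F := by
  have hD := h.comp (isLocalCoordinateChange_continuousLinearEquiv (.refl ℝ _)) hβ hb₀
  have haxis := (taylorCoeffAtZero_of_axis_eventuallyEq (n := m) (k := fun t => 0 - w t)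
    (f := fun x => x.2 - ψ x.1) ((SmoothNear.of_contDiff contDiff_const 0).sub hw)
    (hψ.mono fun t ht => by simp [ht])).1
  exact (hD.le_newtonDist hn fun i hi => haxis i (by omega)).trans (newtonDist_le_linHeight F)

theorem newtonDist_comp_le_of_axis (h : IsPrenormalForm F b ψ b₀) (hm : 2 ≤ m)
    (hw : SmoothNear w 0) (hw0 : w 0 ≠ 0) (hψ : ψ =ᶠ[𝓝 0] fun t => t ^ m * w t)
    (hβ : SmoothNear β 0) (hb₀ : b₀ =ᶠ[𝓝 0] fun t => t ^ (2 * m + 1) * β t)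
    (L : (ℝ × ℝ) ≃L[ℝ] (ℝ × ℝ))
    (hr : taylorCoeffAtZero (fun x => (L x).2 - ψ (L x).1) (1, 0) = 0) :
    newtonDist (F ∘ L) ≤ ENNReal.ofReal (2 * (2 * m + 1 : ℕ) / ((2 * m + 1 : ℕ) + 1)) := by
  have hL := isLocalCoordinateChange_continuousLinearEquiv L
  have hD := h.comp hL hβ hb₀
  have hdL : HasFDerivAt L (L : ℝ × ℝ →L[ℝ] ℝ × ℝ) 0 := L.hasFDerivAt
  set α := (L (1, 0)).1
  have hα0 : α ≠ 0 := by
    have hV := (hD.ne_zero_of_axis hr).2.1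
    rw [hL.1.fst.taylorCoeffAtZero_one_zero, hdL.fst.fderiv] at hV
    simpa using hV
  have hL2 : (L (1, 0)).2 = 0 := by
    rw [hD.smooth_U.taylorCoeffAtZero_one_zero,
      (h.hasFDerivAt_snd_sub_ψ hL.1 hL.2.1).fderiv, hdL.fderiv] at hr
    exact hr
  have haxis (t : ℝ) : L (t, 0) = (α * t, 0) := by
    rw [show ((t, 0) : ℝ × ℝ) = t • (1, 0) by simp, map_smul]
    exact Prod.ext (mul_comm _ _) (by simp [hL2])
  have hscale : SmoothNear (fun t : ℝ => α * t) 0 := .of_contDiff (by fun_prop) 0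
  have hscale0 : Tendsto (fun t : ℝ => α * t) (𝓝 0) (𝓝 0) := by
    simpa using hscale.continuousAt.tendsto
  obtain ⟨hlow, htop⟩ := taylorCoeffAtZero_of_axis_eventuallyEq (n := m)
    (f := fun x => (L x).2 - ψ (L x).1) (k := fun t => -α ^ m * w (α * t))
    ((SmoothNear.of_contDiff contDiff_const 0).mul
      (SmoothNear.comp (f := w) (by simpa using hw) hscale)) <| by
    filter_upwards [hscale0.eventually hψ] with t ht
    rw [haxis, ht]
    ring
  have hdiv : (2 * m + 1) / 2 = m := by omega
  refine hD.newtonDist_le_of_vanishing_axis (by omega) (by rwa [hdiv]) (.inl ?_)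
  rw [hdiv, htop]
  simp [hα0, hw0]

theorem linHeight_le (h : IsPrenormalForm F b ψ b₀) (hm : 2 ≤ m) (hw : SmoothNear w 0)
    (hw0 : w 0 ≠ 0) (hψ : ψ =ᶠ[𝓝 0] fun t => t ^ m * w t) (hβ : SmoothNear β 0)
    (hb₀ : b₀ =ᶠ[𝓝 0] fun t => t ^ (2 * m + 1) * β t) :
    linHeight F ≤ ENNReal.ofReal (2 * (2 * m + 1 : ℕ) / ((2 * m + 1 : ℕ) + 1)) :=
  have haxis := h.newtonDist_comp_le_of_axis hm hw hw0 hψ hβ hb₀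
  iSup_le fun L => (h.comp (isLocalCoordinateChange_continuousLinearEquiv L) hβ
    hb₀).newtonDist_le_of_cases (by omega) (three_halves_le_two_mul_div (by omega)) (haxis L)
    (haxis ((ContinuousLinearEquiv.prodComm ℝ ℝ ℝ).trans L))

end IsPrenormalForm

theorem ofReal_two_mul_div (n : ℕ) :
    ENNReal.ofReal (2 * n / (n + 1)) = 2 * (n : ℝ≥0∞) / ((n : ℝ≥0∞) + 1) := by
  rw [ENNReal.ofReal_div_of_pos (by positivity), ENNReal.ofReal_mul (by norm_num),
    ENNReal.ofReal_add (by positivity) (by norm_num)]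
  simp

theorem ofReal_two_mul_div_odd (m : ℕ) :
    ENNReal.ofReal (2 * (2 * m + 1 : ℕ) / ((2 * m + 1 : ℕ) + 1)) =
      (2 * (m : ℝ≥0∞) + 1) / ((m : ℝ≥0∞) + 1) := by
  have hcancel :
      (2 * (2 * m + 1 : ℕ) / ((2 * m + 1 : ℕ) + 1) : ℝ) = (2 * m + 1 : ℕ) / (m + 1) := by
    push_cast
    field_simp
    ring
  rw [hcancel, ENNReal.ofReal_div_of_pos (by positivity),
    ENNReal.ofReal_add (by positivity) (by norm_num), ENNReal.ofReal_natCast]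
  simp

theorem two_le_of_forall_two_mul_div_le {h : ℝ≥0∞}
    (H : ∀ n : ℕ, 4 ≤ n → ENNReal.ofReal (2 * n / (n + 1)) ≤ h) : 2 ≤ h := by
  have hlim : Tendsto (fun n : ℕ => (2 : ℝ) * n / (n + 1)) atTop (𝓝 2) := by
    simpa [mul_div_assoc] using (tendsto_natCast_div_add_atTop (1 : ℝ)).const_mul 2
  have hlim' := (ENNReal.continuous_ofReal.tendsto 2).comp hlim
  rw [ENNReal.ofReal_ofNat] at hlim'
  exact le_of_tendsto hlim' ((eventually_ge_atTop 4).mono H)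

theorem ofReal_two_mul_div_lt {l n : ℕ} (hln : l < n) :
    ENNReal.ofReal (2 * l / (l + 1)) < ENNReal.ofReal (2 * n / (n + 1)) := by
  have hln' : (l : ℝ) < n := by exact_mod_cast hln
  have hn : (0 : ℝ) < n := l.cast_nonneg.trans_lt hln'
  rw [ENNReal.ofReal_lt_ofReal_iff (by positivity), div_lt_div_iff₀ (by positivity) (by positivity)]
  linarith

theorem ofReal_two_mul_div_lt_two (n : ℕ) : ENNReal.ofReal (2 * n / (n + 1)) < 2 := by
  rw [← ENNReal.ofReal_ofNat, ENNReal.ofReal_lt_ofReal_iff (by norm_num),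
    div_lt_iff₀ (by positivity)]
  linarith

theorem SmoothNear.exists_contDiff_eq_pow_mul {f : ℝ → ℝ} (hf : SmoothNear f 0) {n : ℕ}
    (h : ∀ i < n, iteratedDeriv i f 0 = 0) :
    ∃ g : ℝ → ℝ, ContDiff ℝ ∞ g ∧ (f =ᶠ[𝓝 0] fun t => t ^ n * g t) ∧
      g 0 = iteratedDeriv n f 0 / n.factorial := by
  obtain ⟨F, hF, hfF⟩ := hf.exists_contDiff
  obtain ⟨g, hg, hFg, hg0⟩ := _root_.exists_contDiff_eq_pow_mul hF (n := n) fun i hi => by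
    rw [← hfF.iteratedDeriv_eq, h i hi]
  exact ⟨g, hg, hfF.trans (.of_forall hFg), by rw [hg0, hfF.iteratedDeriv_eq]⟩

theorem HasVanishingOrder.exists_eq_pow_mul {b₀ : ℝ → ℝ} {n : ℕ∞} (h : HasVanishingOrder b₀ n)
    (hb₀ : SmoothNear b₀ 0) {l : ℕ} (hl : (l : ℕ∞) ≤ n) :
    ∃ β : ℝ → ℝ, SmoothNear β 0 ∧ b₀ =ᶠ[𝓝 0] fun t => t ^ l * β t := by
  rcases h with ⟨k, rfl, β, hβ, -, hb₀β⟩ | ⟨rfl, hflat⟩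
  · refine ⟨fun t => t ^ (k - l) * β t, (SmoothNear.of_contDiff (by fun_prop) 0).mul hβ,
      hb₀β.mono fun t ht => ?_⟩
    beta_reduce
    rw [ht, ← mul_assoc, ← pow_add, Nat.add_sub_cancel' (by exact_mod_cast hl)]
  · obtain ⟨β, hβ, hb₀β, -⟩ := hb₀.exists_contDiff_eq_pow_mul fun i (_ : i < l) => hflat i
    exact ⟨β, .of_contDiff hβ 0, hb₀β⟩

namespace HasNormalForm

variable {φ : ℝ × ℝ → ℝ} {m : ℕ} {n : ℕ∞}

theorem exists_isPrenormalForm (h : HasNormalForm φ m n) :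
    ∃ (L : (ℝ × ℝ) ≃L[ℝ] (ℝ × ℝ)) (b : ℝ × ℝ → ℝ) (w b₀ : ℝ → ℝ),
      IsPrenormalForm (φ ∘ L) b (fun t => t ^ m * w t) b₀ ∧ SmoothNear w 0 ∧ w 0 ≠ 0 ∧ 2 ≤ m ∧
      ((2 * m + 1 : ℕ) : ℕ∞) < n ∧ HasVanishingOrder b₀ n := by
  obtain ⟨L, b, w, b₀, hb, hw, hb₀, hform, hb0, hb10, hb01, hm, hw0, hn, hv⟩ := h
  refine ⟨L, b, w, b₀, ⟨hform, hb, (SmoothNear.of_contDiff (by fun_prop) 0).mul hw, hb₀, hb0,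
    fun h => hb10 (taylorCoeffAtZero_eq_zero_iff.1 h), taylorCoeffAtZero_eq_zero_iff.2 hb01,
    ?_, ?_⟩, hw, hw0, hm, hn, hv⟩
  · simp [show m ≠ 0 by omega]
  · have hderiv := (hasDerivAt_pow m (0 : ℝ)).mul hw.differentiableAt.hasDerivAt
    exact hderiv.deriv.trans (by simp [show m ≠ 0 by omega, show m - 1 ≠ 0 by omega])

theorem height_eq_natCast {n : ℕ} (h : HasNormalForm φ m n) :
    height φ = ENNReal.ofReal (2 * n / (n + 1)) := by
  obtain ⟨L, b, w, b₀, hF, -, -, hm, hn, hv⟩ := h.exists_isPrenormalForm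
  have hn' : 2 * m + 1 < n := by exact_mod_cast hn
  obtain ⟨k, hk, β, hβ, hβ0, hb₀⟩ := hv.resolve_right fun h => ENat.natCast_ne_top n h.1
  obtain rfl : n = k := by exact_mod_cast hk
  rw [← height_comp_continuousLinearEquiv φ L]
  exact (hF.height_le (by omega) hβ hβ0 hb₀).antisymm (hF.le_height (by omega) hβ hb₀)

theorem height_eq_two (h : HasNormalForm φ m ⊤) : height φ = 2 := by
  obtain ⟨L, b, w, b₀, hF, -, -, -, -, hv⟩ := h.exists_isPrenormalForm
  have hβ (l : ℕ) := hv.exists_eq_pow_mul hF.smooth_b₀ (l := l) le_top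
  rw [← height_comp_continuousLinearEquiv φ L]
  refine le_antisymm ?_ (two_le_of_forall_two_mul_div_le fun l hl => ?_)
  · obtain ⟨β, hβ, hb₀⟩ := hβ 4
    exact hF.height_le_two le_rfl hβ hb₀
  · obtain ⟨β, hβ, hb₀⟩ := hβ l
    exact hF.le_height hl hβ hb₀

theorem linHeight_eq (h : HasNormalForm φ m n) :
    linHeight φ = ENNReal.ofReal (2 * (2 * m + 1 : ℕ) / ((2 * m + 1 : ℕ) + 1)) := by
  obtain ⟨L, b, w, b₀, hF, hw, hw0, hm, hn, hv⟩ := h.exists_isPrenormalForm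
  obtain ⟨β, hβ, hb₀⟩ := hv.exists_eq_pow_mul hF.smooth_b₀ hn.le
  rw [← linHeight_comp_continuousLinearEquiv φ L]
  exact (hF.linHeight_le hm hw hw0 .rfl hβ hb₀).antisymm
    (hF.le_linHeight (by omega) le_rfl hw .rfl hβ hb₀)

theorem partialAtZero_eq_zero (h : HasNormalForm φ m n) {i j : ℕ} (hij : i + j ≤ 2) :
    partialAtZero i j φ = 0 := by
  obtain ⟨L, b, w, b₀, hF, -, -, hm, hn, hv⟩ := h.exists_isPrenormalForm
  obtain ⟨β, hβ, hb₀⟩ := hv.exists_eq_pow_mul hF.smooth_b₀ (l := 4)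
    (le_trans (by exact_mod_cast (by omega : 4 ≤ 2 * m + 1)) hn.le)
  have hD := hF.comp (isLocalCoordinateChange_continuousLinearEquiv L.symm) hβ hb₀
  have hφ : (φ ∘ L) ∘ L.symm = φ := by ext x; simp
  rw [hφ] at hD
  exact taylorCoeffAtZero_eq_zero_iff.1 <|
    (hD.hasInitialForm_cubic le_rfl).taylorCoeffAtZero_eq_zero hD.smoothNear one_pos one_pos
      (by omega)

theorem height_le_two_and_linHeight_lt (h : HasNormalForm φ m n) :
    height φ ≤ 2 ∧ linHeight φ < height φ := by
  obtain ⟨-, -, -, -, -, -, -, -, hn, -⟩ := h.exists_isPrenormalForm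
  rw [h.linHeight_eq]
  induction n using ENat.recTopCoe with
  | top =>
    rw [h.height_eq_two]
    exact ⟨le_rfl, ofReal_two_mul_div_lt_two _⟩
  | coe n =>
    rw [h.height_eq_natCast]
    exact ⟨(ofReal_two_mul_div_lt_two n).le, ofReal_two_mul_div_lt (by exact_mod_cast hn)⟩

end HasNormalForm

section ImplicitFunction

theorem isInvertible_of_apply_one_ne_zero {𝕜 : Type*} [NontriviallyNormedField 𝕜] {A : 𝕜 →L[𝕜] 𝕜}
    (hA : A 1 ≠ 0) : A.IsInvertible :=
  ⟨ContinuousLinearEquiv.unitsEquivAut 𝕜 (Units.mk0 _ hA), by ext; simp⟩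

variable {E₁ E₂ F : Type*} [NormedAddCommGroup E₁] [NormedSpace ℝ E₁] [CompleteSpace E₁]
  [NormedAddCommGroup E₂] [NormedSpace ℝ E₂] [CompleteSpace E₂]
  [NormedAddCommGroup F] [NormedSpace ℝ F] [CompleteSpace F] {f : E₁ × E₂ → F}

theorem contDiffAt_of_eventually_apply_eq {n : WithTop ℕ∞} (hn : n ≠ 0) {ζ : E₁ → E₂} {x : E₁}
    (hf : ContDiffAt ℝ n f (x, ζ x))
    (hinv : (fderiv ℝ f (x, ζ x) ∘L .inr ℝ E₁ E₂).IsInvertible) (hζ : ContinuousAt ζ x)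
    (hfζ : ∀ᶠ y in 𝓝 x, f (y, ζ y) = f (x, ζ x)) : ContDiffAt ℝ n ζ x := by
  have hgraph : Tendsto (fun y => (y, ζ y)) (𝓝 x) (𝓝 (x, ζ x)) := continuousAt_id.prodMk hζ
  refine (hf.contDiffAt_implicitFunction hn hinv).congr_of_eventuallyEq ?_
  filter_upwards [hgraph.eventually (hf.eventually_apply_eq_iff_implicitFunction hn hinv), hfζ]
    with y huniq hy
  exact (huniq.1 hy).symm

theorem SmoothNear.exists_implicitFunction {u : E₁ × E₂} (hf : SmoothNear f u)
    (hinv : (fderiv ℝ f u ∘L .inr ℝ E₁ E₂).IsInvertible) :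
    ∃ ζ : E₁ → E₂, SmoothNear ζ u.1 ∧ ζ u.1 = u.2 ∧ ∀ᶠ x in 𝓝 u.1, f (x, ζ x) = f u := by
  have hn : (∞ : WithTop ℕ∞) ≠ 0 := by simp
  have hfu := hf.contDiffAt
  set ζ := hfu.implicitFunction hn hinv
  have hζu : ζ u.1 = u.2 := hfu.implicitFunction_apply_self hn hinv
  have hfζ : ∀ᶠ x in 𝓝 u.1, f (x, ζ x) = f u := hfu.eventually_apply_implicitFunction hn hinv
  have hζ : ContDiffAt ℝ ∞ ζ u.1 := hfu.contDiffAt_implicitFunction hn hinv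
  have hgraph : Tendsto (fun x => (x, ζ x)) (𝓝 u.1) (𝓝 u) := by
    simpa [hζu] using continuousAt_id.tendsto.prodMk_nhds hζ.continuousAt.tendsto
  have hinv' : ∀ᶠ v in 𝓝 u, (fderiv ℝ f v ∘L .inr ℝ E₁ E₂).IsInvertible :=
    ((hfu.fderiv_right (m := 0) (by simp)).continuousAt.clm_comp continuousAt_const).eventually
      (ContinuousLinearEquiv.isOpen.mem_nhds hinv)
  refine ⟨ζ, SmoothNear.iff_eventually_contDiffAt.2 ?_, hζu, hfζ⟩
  filter_upwards [hgraph.eventually hinv', hgraph.eventually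
    (SmoothNear.iff_eventually_contDiffAt.1 hf), hfζ, hfζ.eventually_nhds,
    ((hζ.of_le (m := 1) (by simp)).eventually (by simp))] with x hinvx hfx hx hx' hζx
  exact contDiffAt_of_eventually_apply_eq hn hfx hinvx hζx.continuousAt
    (hx'.mono fun y hy => hy.trans hx.symm)

end ImplicitFunction

section CriticalGraph

variable {E G : Type*} [NormedAddCommGroup E] [NormedSpace ℝ E]
  [NormedAddCommGroup G] [NormedSpace ℝ G] {f : E × ℝ → G}

theorem hasDerivAt_prodMk_left {x : E} {t : ℝ} (hf : DifferentiableAt ℝ f (x, t)) :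
    HasDerivAt (fun s => f (x, s)) (fderiv ℝ f (x, t) (0, 1)) t :=
  hf.hasFDerivAt.comp_hasDerivAt t ((hasDerivAt_const t x).prodMk (hasDerivAt_id t))

variable [FiniteDimensional ℝ E] [CompleteSpace G]

theorem exists_contDiff_eq_add_smul_deriv_add_sq_smul (hf : ContDiff ℝ ∞ f) :
    ∃ g : E × ℝ → G, ContDiff ℝ ∞ g ∧
      ∀ z, f z = f (z.1, 0) + z.2 • deriv (fun t => f (z.1, t)) 0 + z.2 ^ 2 • g z := by
  obtain ⟨k, hk, hfk⟩ := exists_contDiff_eq_add_snd_smul hf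
  obtain ⟨g, hg, hkg⟩ := exists_contDiff_eq_add_snd_smul hk
  refine ⟨g, hg, fun z => ?_⟩
  have hslice : HasDerivAt (fun t : ℝ => f (z.1, t)) (k (z.1, 0)) 0 := by
    have hk' := hasDerivAt_prodMk_left (hk.differentiable (by simp) (z.1, (0 : ℝ)))
    have hadd := ((hasDerivAt_id (0 : ℝ)).smul hk').const_add (f (z.1, 0))
    simpa using hadd.congr_of_eventuallyEq (.of_forall fun t => hfk (z.1, t))
  rw [hslice.deriv, hfk z, hkg z, smul_add, smul_smul, ← sq, add_assoc]

theorem exists_contDiff_eq_sq_smul_add {ψ : E → ℝ} (hf : ContDiff ℝ ∞ f) (hψ : ContDiff ℝ ∞ ψ) :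
    ∃ b : E × ℝ → G, ContDiff ℝ ∞ b ∧ ∀ x : E × ℝ, fderiv ℝ f (x.1, ψ x.1) (0, 1) = 0 →
      f x = (x.2 - ψ x.1) ^ 2 • b x + f (x.1, ψ x.1) := by
  obtain ⟨b, hb, hfb⟩ := exists_contDiff_eq_add_smul_deriv_add_sq_smul
    (f := fun x : E × ℝ => f (x.1, x.2 + ψ x.1)) (by fun_prop)
  refine ⟨fun x => b (x.1, x.2 - ψ x.1), by fun_prop, fun x hx => ?_⟩
  have hcrit : deriv (fun t => f (x.1, t + ψ x.1)) 0 = 0 := by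
    rw [deriv_comp_add_const (fun t => f (x.1, t)), zero_add,
      (hasDerivAt_prodMk_left (hf.differentiable (by simp) _)).deriv, hx]
  simpa [hcrit, add_comm] using hfb (x.1, x.2 - ψ x.1)

end CriticalGraph

theorem eq_of_tendsto_pow_mul_div_pow {f g : ℝ → ℝ} (hg : ContinuousAt g 0) {k : ℕ} {a : ℝ}
    (hfg : ∀ t, f t = t ^ k * g t) (hf : Tendsto (fun t => f t / t ^ k) (𝓝[>] 0) (𝓝 a)) :
    g 0 = a := by
  refine tendsto_nhds_unique ((hg.tendsto.mono_left nhdsWithin_le_nhds).congr' ?_) hf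
  filter_upwards [self_mem_nhdsWithin] with t ht
  rw [hfg, mul_div_cancel_left₀ _ (pow_pos ht k).ne']

theorem exists_contDiff_eq_pow_mul_of_tendsto {E : Type*} [NormedAddCommGroup E]
    [NormedSpace ℝ E] [FiniteDimensional ℝ E] {f : E × ℝ → ℝ} (hf : ContDiff ℝ ∞ f) {k : ℕ}
    {P : E → ℝ} (hP : ∀ x, Tendsto (fun t => f (x, t) / t ^ k) (𝓝[>] 0) (𝓝 (P x))) :
    ∃ g : E × ℝ → ℝ, ContDiff ℝ ∞ g ∧ (∀ z, f z = z.2 ^ k * g z) ∧ ∀ x, g (x, 0) = P x := by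
  have hslice {g : E × ℝ → ℝ} (hg : ContDiff ℝ ∞ g) (x : E) : ContinuousAt (fun t => g (x, t)) 0 :=
    (hg.continuous.comp (Continuous.prodMk_right x)).continuousAt
  induction k generalizing P with
  | zero =>
    exact ⟨f, hf, by simp, fun x => eq_of_tendsto_pow_mul_div_pow (k := 0) (hslice hf x) (by simp)
      (hP x)⟩
  | succ k ih =>
    have hP' (x : E) : Tendsto (fun t => f (x, t) / t ^ k) (𝓝[>] 0) (𝓝 0) := by
      have ht : Tendsto (fun t : ℝ => t) (𝓝[>] 0) (𝓝 0) := nhdsWithin_le_nhds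
      have hmul := ht.mul (hP x)
      rw [zero_mul] at hmul
      refine hmul.congr' ?_
      filter_upwards [self_mem_nhdsWithin] with t (ht : 0 < t)
      field_simp
      ring
    obtain ⟨g, hg, hfg, hg0⟩ := ih hP'
    obtain ⟨g', hg', hgg'⟩ := exists_contDiff_eq_add_snd_smul hg
    have hfg' (z : E × ℝ) : f z = z.2 ^ (k + 1) * g' z := by
      rw [hfg, hgg', hg0, zero_add, smul_eq_mul, pow_succ, mul_assoc]
    exact ⟨g', hg', hfg', fun x => eq_of_tendsto_pow_mul_div_pow (hslice hg' x)
      (fun t => hfg' (x, t)) (hP x)⟩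

theorem HasInitialForm.exists_contDiff_blowup {f P : ℝ × ℝ → ℝ} {k : ℕ}
    (h : HasInitialForm f 1 1 k P) (hf : ContDiff ℝ ∞ f) : ∃ g : ℝ × ℝ → ℝ, ContDiff ℝ ∞ g ∧
      (∀ t s, f (t, t * s) = t ^ k * g (t, s)) ∧ ∀ s, g (0, s) = P (1, s) := by
  obtain ⟨g, hg, hfg, hg0⟩ := exists_contDiff_eq_pow_mul_of_tendsto
    (f := fun z : ℝ × ℝ => f (z.2, z.2 * z.1)) (k := k) (P := fun s => P (1, s)) (by fun_prop)
    fun s => by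
      simpa [Function.comp_def] using (h (1, s)).comp (tendsto_id.prodMk tendsto_const_nhds)
  exact ⟨fun z => g (z.2, z.1), by fun_prop, fun t s => hfg (s, t), hg0⟩

theorem HasInitialForm.exists_contDiff_branch {f P : ℝ × ℝ → ℝ} {k : ℕ}
    (h : HasInitialForm f 1 1 k P) (hf : ContDiff ℝ ∞ f) (hP : P (1, 0) = 0)
    (hP' : deriv (fun s => P (1, s)) 0 ≠ 0) :
    ∃ ζ : ℝ → ℝ, ContDiff ℝ ∞ ζ ∧ ∀ᶠ t in 𝓝 0, f (t, t ^ 2 * ζ t) = 0 := by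
  obtain ⟨g, hg, hfg, hg0⟩ := h.exists_contDiff_blowup hf
  have hg0' : fderiv ℝ g 0 (0, 1) = deriv (fun s => P (1, s)) 0 := by
    rw [← funext hg0]
    exact (hasDerivAt_prodMk_left (hg.differentiable (by simp) _)).deriv.symm
  obtain ⟨η, hη, hη0, hgη⟩ := (SmoothNear.of_contDiff hg 0).exists_implicitFunction
    (isInvertible_of_apply_one_ne_zero (by simpa [hg0'] using hP'))
  obtain ⟨η', hη', hηη'⟩ := hη.exists_contDiff
  obtain ⟨ζ, hζ, hη'ζ⟩ := exists_contDiff_eq_add_id_smul hη'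
  have hη'0 : η' 0 = 0 := hηη'.self_of_nhds.symm.trans hη0
  refine ⟨ζ, hζ, (hgη.and hηη').mono fun t ⟨hgt, hηt⟩ => ?_⟩
  have hcurve : t ^ 2 * ζ t = t * η t := by
    rw [hηt, hη'ζ, hη'0, zero_add, smul_eq_mul, sq, mul_assoc]
  rw [hcurve, hfg, hgt, ← Prod.mk_zero_zero, hg0, hP, mul_zero]

theorem taylorCoeffAtZero_fderiv_snd {f : ℝ × ℝ → ℝ} (hf : ContDiff ℝ ∞ f) (i j : ℕ) :
    taylorCoeffAtZero (fun x => fderiv ℝ f x (0, 1)) (i, j) =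
      (j + 1) * taylorCoeffAtZero f (i, j + 1) := by
  have hslice (s : ℝ) : deriv (fun t => f (s, t)) = fun t => fderiv ℝ f (s, t) (0, 1) :=
    funext fun t => (hasDerivAt_prodMk_left (hf.differentiable (by simp) (s, t))).deriv
  have hpartial : partialAtZero i j (fun x => fderiv ℝ f x (0, 1)) = partialAtZero i (j + 1) f := by
    simp only [partialAtZero, iteratedDeriv_succ', hslice]
  rw [taylorCoeffAtZero, taylorCoeffAtZero, hpartial, Nat.factorial_succ]
  push_cast
  field_simp

theorem HasInitialForm.fderiv_snd {f : ℝ × ℝ → ℝ} {c : ℝ}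
    (h : HasInitialForm f 1 1 3 fun x => c * x.1 * x.2 ^ 2) (hf : ContDiff ℝ ∞ f) :
    HasInitialForm (fun x => fderiv ℝ f x (0, 1)) 1 1 2 fun x => 2 * c * x.1 * x.2 := by
  have hdf : ContDiff ℝ ∞ fun x => fderiv ℝ f x (0, 1) :=
    (hf.fderiv_right (by simp)).clm_apply contDiff_const
  have hlow {i j : ℕ} := h.taylorCoeffAtZero_eq_zero (.of_contDiff hf 0) one_pos one_pos
    (i := i) (j := j)
  have htop {i j : ℕ} := h.taylorCoeffAtZero_eq (.of_contDiff hf 0) one_pos one_pos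
    (Q := .C c * .X) (by simp) (i := i) (j := j)
  refine ((SmoothNear.of_contDiff hdf 0).hasInitialForm_weightedPart one_pos one_pos
    fun i j hij => ?_).congr_right fun x => ?_
  · rw [taylorCoeffAtZero_fderiv_snd hf, hlow (by omega), mul_zero]
  · simp [weightedPart, Finset.sum_filter, Finset.sum_product_right, Finset.sum_range_succ,
      taylorCoeffAtZero_fderiv_snd hf, htop, Polynomial.coeff_X]
    ring

theorem HasInitialForm.exists_critical_curve {f : ℝ × ℝ → ℝ} {c : ℝ}
    (h : HasInitialForm f 1 1 3 fun x => c * x.1 * x.2 ^ 2) (hf : ContDiff ℝ ∞ f) (hc : c ≠ 0) :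
    ∃ ζ : ℝ → ℝ, ContDiff ℝ ∞ ζ ∧ ∀ᶠ t in 𝓝 0, fderiv ℝ f (t, t ^ 2 * ζ t) (0, 1) = 0 :=
  (h.fderiv_snd hf).exists_contDiff_branch ((hf.fderiv_right (by simp)).clm_apply contDiff_const)
    (by simp) (by simpa [deriv_const_mul_id'] using hc)

theorem HasInitialForm.exists_eq_pow_four_mul {f : ℝ × ℝ → ℝ} {c : ℝ}
    (h : HasInitialForm f 1 1 3 fun x => c * x.1 * x.2 ^ 2) (hf : ContDiff ℝ ∞ f) {ζ : ℝ → ℝ}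
    (hζ : ContDiff ℝ ∞ ζ) :
    ∃ β : ℝ → ℝ, ContDiff ℝ ∞ β ∧ ∀ t, f (t, t ^ 2 * ζ t) = t ^ 4 * β t := by
  obtain ⟨g, hg, hfg, hg0⟩ := h.exists_contDiff_blowup hf
  obtain ⟨β, hβ, hgβ⟩ := exists_contDiff_eq_add_id_smul (f := fun t => g (t, t * ζ t)) (by fun_prop)
  refine ⟨β, hβ, fun t => ?_⟩
  rw [sq, mul_assoc, hfg, hgβ, zero_mul, hg0, smul_eq_mul]
  ring

theorem HasInitialForm.linear_part_eq_of_mul_sq {b u : ℝ × ℝ → ℝ} {c : ℝ} (hb : SmoothNear b 0)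
    (hu : HasInitialForm u 1 1 1 fun x => x.2)
    (h : HasInitialForm (fun x => b x * u x ^ 2) 1 1 3 fun x => c * x.1 * x.2 ^ 2) :
    b 0 = 0 ∧ taylorCoeffAtZero b (1, 0) = c ∧ taylorCoeffAtZero b (0, 1) = 0 := by
  have hb0 : b 0 = 0 := by
    have heq := (h.of_lt (l := 2) (by norm_num)).unique
      ((HasInitialForm.of_continuousAt one_pos one_pos hb.continuousAt).mul (hu.pow 2))
    simpa using (congr_fun heq (0, 1)).symm
  have heq := h.unique ((hb.hasInitialForm_linear hb0).mul (hu.pow 2))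
  have h01 : taylorCoeffAtZero b (0, 1) = 0 := by simpa using (congr_fun heq (0, 1)).symm
  exact ⟨hb0, by simpa [h01] using (congr_fun heq (1, 1)).symm, h01⟩

theorem HasInitialForm.exists_isPrenormalForm {f : ℝ × ℝ → ℝ} {c : ℝ}
    (h : HasInitialForm f 1 1 3 fun x => c * x.1 * x.2 ^ 2) (hf : ContDiff ℝ ∞ f) (hc : c ≠ 0) :
    ∃ (b : ℝ × ℝ → ℝ) (ζ β : ℝ → ℝ), ContDiff ℝ ∞ ζ ∧ ContDiff ℝ ∞ β ∧
      IsPrenormalForm f b (fun t => t ^ 2 * ζ t) (fun t => t ^ 4 * β t) := by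
  obtain ⟨ζ, hζ, hcrit⟩ := h.exists_critical_curve hf hc
  have hψ : ContDiff ℝ ∞ fun t => t ^ 2 * ζ t := by fun_prop
  obtain ⟨b, hb, hfb⟩ := exists_contDiff_eq_sq_smul_add hf hψ
  obtain ⟨β, hβ, hfβ⟩ := h.exists_eq_pow_four_mul hf hζ
  have hform : f =ᶠ[𝓝 0] fun x => b x * (x.2 - x.1 ^ 2 * ζ x.1) ^ 2 + x.1 ^ 4 * β x.1 := by
    filter_upwards [(continuous_fst.tendsto (0 : ℝ × ℝ)).eventually hcrit] with x hx
    rw [hfb x hx, hfβ, smul_eq_mul, mul_comm (b x)]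
  have hb₀ : HasInitialForm (fun x : ℝ × ℝ => x.1 ^ 4 * β x.1) 1 1 3 fun _ => 0 :=
    ((HasInitialForm.fst 1).comp_of_eventuallyEq_pow_mul one_pos one_pos continuousAt_fst rfl
      hβ.continuous.continuousAt (.of_forall fun _ => rfl)).of_lt (by norm_num)
  have hψ₁ : HasInitialForm (fun x : ℝ × ℝ => x.1 ^ 2 * ζ x.1) 1 1 1 fun _ => 0 :=
    ((HasInitialForm.fst 1).comp_of_eventuallyEq_pow_mul one_pos one_pos continuousAt_fst rfl
      hζ.continuous.continuousAt (.of_forall fun _ => rfl)).of_lt (by norm_num)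
  have hsq := ((h.sub hb₀).congr one_pos one_pos (g := fun x => b x * (x.2 - x.1 ^ 2 * ζ x.1) ^ 2)
    (hform.mono fun x hx => by simp [hx])).congr_right fun x => sub_zero _
  obtain ⟨hb0, hb10, hb01⟩ := HasInitialForm.linear_part_eq_of_mul_sq (.of_contDiff hb 0)
    (((HasInitialForm.snd 1).sub hψ₁).congr_right fun x => sub_zero _) hsq
  have hψ' : HasDerivAt (fun t => t ^ 2 * ζ t) 0 0 := by
    simpa using (hasDerivAt_pow 2 (0 : ℝ)).fun_mul (hζ.differentiable (by simp) 0).hasDerivAt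
  exact ⟨b, ζ, β, hζ, hβ, hform, .of_contDiff hb 0, .of_contDiff hψ 0,
    .of_contDiff (by fun_prop) 0, hb0, by rwa [hb10], hb01, by simp, hψ'.deriv⟩

theorem SmoothNear.exists_hasVanishingOrder {f : ℝ → ℝ} (hf : SmoothNear f 0) :
    ∃ n : ℕ∞, HasVanishingOrder f n := by
  classical
  by_cases hflat : ∀ i, iteratedDeriv i f 0 = 0
  · exact ⟨⊤, .inr ⟨rfl, hflat⟩⟩
  push Not at hflat
  obtain ⟨g, hg, hfg, hg0⟩ := hf.exists_contDiff_eq_pow_mul (n := Nat.find hflat)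
    fun i hi => not_not.1 (Nat.find_min hflat hi)
  refine ⟨_, .inl ⟨_, rfl, g, .of_contDiff hg 0, ?_, hfg⟩⟩
  rw [hg0]
  exact div_ne_zero (Nat.find_spec hflat) (by positivity)

theorem HasVanishingOrder.le_of_eventuallyEq_pow_mul {f g : ℝ → ℝ} {l : ℕ} {n : ℕ∞}
    (h : HasVanishingOrder f n) (hg : SmoothNear g 0) (hfg : f =ᶠ[𝓝 0] fun t => t ^ l * g t) :
    (l : ℕ∞) ≤ n := by
  rcases h with ⟨k, rfl, β, hβ, hβ0, hfβ⟩ | ⟨rfl, -⟩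
  swap
  · exact le_top
  rw [Nat.cast_le]
  by_contra! hkl
  have hβg : β =ᶠ[𝓝[≠] 0] fun t => t ^ (l - k) * g t := by
    filter_upwards [self_mem_nhdsWithin, nhdsWithin_le_nhds hfβ, nhdsWithin_le_nhds hfg]
      with t (ht : t ≠ 0) htβ htg
    refine mul_left_cancel₀ (pow_ne_zero k ht) ?_
    rw [← htβ, htg, ← mul_assoc, ← pow_add, Nat.add_sub_cancel' hkl.le]
  have hcont : ContinuousAt (fun t => t ^ (l - k) * g t) 0 :=
    (continuousAt_id.pow _).mul hg.continuousAt
  refine hβ0 (tendsto_nhds_unique ((hβ.continuousAt.tendsto.mono_left nhdsWithin_le_nhds).congr'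
    hβg) ?_)
  simpa [Nat.sub_ne_zero_of_lt hkl] using hcont.tendsto.mono_left nhdsWithin_le_nhds

section InitialForm

variable {f g P : ℝ × ℝ → ℝ} {p q k : ℕ}

theorem HasInitialForm.weightedPart_eq (h : HasInitialForm f p q k P) (hf : SmoothNear f 0)
    (hp : 0 < p) (hq : 0 < q) : weightedPart f p q k = P :=
  (hf.hasInitialForm_weightedPart hp hq fun _ _ => h.taylorCoeffAtZero_eq_zero hf hp hq).unique h

theorem HasInitialForm.taylorCoeffAtZero_eq_apply_one_zero {i : ℕ}
    (h : HasInitialForm f p q (p * i) P) (hf : SmoothNear f 0) (hp : 0 < p) (hq : 0 < q) :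
    taylorCoeffAtZero f (i, 0) = P (1, 0) := by
  rw [← h.weightedPart_eq hf hp hq, weightedPart, Finset.sum_eq_single_of_mem (i, 0)]
  · simp
  · simpa using Nat.lt_succ_of_le (Nat.le_mul_of_pos_left i hp)
  · intro α hα hne
    have hα2 : α.2 ≠ 0 := fun h0 => hne (Prod.ext (by simp_all [hp.ne']) h0)
    simp [hα2]

theorem HasInitialForm.taylorCoeffAtZero_eq_apply_zero_one {j : ℕ}
    (h : HasInitialForm f p q (q * j) P) (hf : SmoothNear f 0) (hp : 0 < p) (hq : 0 < q) :
    taylorCoeffAtZero f (0, j) = P (0, 1) := by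
  have hswap : HasInitialForm (fun x => f x.swap) q p (q * j) fun x => P x.swap :=
    h.comp (HasInitialForm.snd q) (HasInitialForm.fst p)
  exact (hf.taylorCoeffAtZero_swap j 0).symm.trans
    (hswap.taylorCoeffAtZero_eq_apply_one_zero hf.comp_swap hq hp)

theorem HasInitialForm.taylorCoeffAtZero_congr (hfP : HasInitialForm f p q k P)
    (hgP : HasInitialForm g p q k P) (hf : SmoothNear f 0) (hg : SmoothNear g 0) (hp : 0 < p)
    (hq : 0 < q) {i j : ℕ} (hij : p * i + q * j = k) :
    taylorCoeffAtZero f (i, j) = taylorCoeffAtZero g (i, j) := by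
  set Q : Polynomial ℝ := ∑ α ∈ Finset.range (k + 1) ×ˢ Finset.range (k + 1) with
    p * α.1 + q * α.2 = k, .C (taylorCoeffAtZero f α) * .X ^ α.1
  have hQ (t : ℝ) : P (t, 1) = Q.eval t := by
    simp [Q, ← hfP.weightedPart_eq hf hp hq, weightedPart, Polynomial.eval_finsetSum]
  rw [hfP.taylorCoeffAtZero_eq hf hp hq hQ hij, hgP.taylorCoeffAtZero_eq hg hp hq hQ hij]

theorem SmoothNear.hasInitialForm_cubic (hf : SmoothNear f 0)
    (h : ∀ i j, i + j ≤ 2 → taylorCoeffAtZero f (i, j) = 0) :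
    HasInitialForm f 1 1 3 fun x => taylorCoeffAtZero f (3, 0) * x.1 ^ 3 +
      taylorCoeffAtZero f (2, 1) * x.1 ^ 2 * x.2 + taylorCoeffAtZero f (1, 2) * x.1 * x.2 ^ 2 +
      taylorCoeffAtZero f (0, 3) * x.2 ^ 3 := by
  refine (hf.hasInitialForm_weightedPart one_pos one_pos fun i j hij =>
    h i j (by omega)).congr_right fun x => ?_
  simp [weightedPart, Finset.sum_filter, Finset.sum_product_right, Finset.sum_range_succ]
  ring

theorem HasInitialForm.comp_fderiv {X : ℝ × ℝ → ℝ × ℝ} (h : HasInitialForm f 1 1 k P)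
    (hX : SmoothNear X 0) (hX0 : X 0 = 0) :
    HasInitialForm (f ∘ X) 1 1 k (P ∘ fderiv ℝ X 0) := by
  have hd := hX.differentiableAt.hasFDerivAt
  refine (h.comp (hX.fst.hasInitialForm_linear (by simp [hX0]))
    (hX.snd.hasInitialForm_linear (by simp [hX0]))).congr_right fun x => congr_arg P ?_
  rw [← hX.fst.fderiv_apply, ← hX.snd.fderiv_apply, hd.fst.fderiv, hd.snd.fderiv]
  rfl

theorem HasInitialForm.comp_continuousLinearEquiv (h : HasInitialForm f 1 1 k P)
    (L : (ℝ × ℝ) ≃L[ℝ] (ℝ × ℝ)) : HasInitialForm (f ∘ L) 1 1 k (P ∘ L) := by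
  simpa [L.fderiv] using h.comp_fderiv (.of_contDiff L.contDiff 0) (map_zero L)

end InitialForm

section CoordinateChange

variable {φ : ℝ × ℝ → ℝ} {X : ℝ × ℝ → ℝ × ℝ}

theorem IsLocalCoordinateChange.smoothNear_comp (hX : IsLocalCoordinateChange X)
    (hφ : SmoothNear φ 0) : SmoothNear (φ ∘ X) 0 :=
  SmoothNear.comp (f := φ) (by rwa [hX.2.1]) hX.1

theorem IsLocalCoordinateChange.hasFDerivAt_comp_swap (hX : IsLocalCoordinateChange X) :
    HasFDerivAt (fun x => X x.swap)
      ((fderiv ℝ X 0).comp (ContinuousLinearEquiv.prodComm ℝ ℝ ℝ : ℝ × ℝ →L[ℝ] ℝ × ℝ)) 0 :=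
  HasFDerivAt.comp (g := X) 0 hX.1.differentiableAt.hasFDerivAt
    (ContinuousLinearEquiv.prodComm ℝ ℝ ℝ).hasFDerivAt

theorem IsLocalCoordinateChange.comp_swap (hX : IsLocalCoordinateChange X) :
    IsLocalCoordinateChange fun x => X x.swap := by
  have hd := hX.hasFDerivAt_comp_swap
  obtain ⟨hXs, hX0, A, hA⟩ := hX
  refine ⟨SmoothNear.comp (f := X) (u := Prod.swap) hXs
    (.of_contDiff (contDiff_snd.prodMk contDiff_fst) 0), hX0,
    (ContinuousLinearEquiv.prodComm ℝ ℝ ℝ).trans A, ?_⟩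
  rw [hd.fderiv, ← hA]
  rfl

theorem IsLocalCoordinateChange.hasInitialForm_coords (hX : IsLocalCoordinateChange X)
    (haxis : (fderiv ℝ X 0 (1, 0)).2 = 0) : ∃ α s δ : ℝ, α ≠ 0 ∧ s ≠ 0 ∧
      HasInitialForm (fun x => (X x).1) 1 2 1 (fun x => α * x.1) ∧
      HasInitialForm (fun x => (X x).2) 1 2 2 (fun x => s * x.2 + δ * x.1 ^ 2) := by
  have hdet := hX.det_ne_zero
  obtain ⟨hXs, hX0, -⟩ := hX
  have hd := hXs.differentiableAt.hasFDerivAt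
  rw [haxis, mul_zero, sub_zero] at hdet
  have hsnd : ∀ i < 2, taylorCoeffAtZero (fun x => (X x).2) (i, 0) = 0 := by
    intro i hi
    interval_cases i
    · simp [taylorCoeffAtZero_zero_zero, hX0]
    · rwa [hXs.snd.taylorCoeffAtZero_one_zero, hd.snd.fderiv]
  refine ⟨_, _, _, ?_, ?_, hXs.fst.hasInitialForm_fst (by simp [hX0]) one_pos one_lt_two,
    hXs.snd.hasInitialForm_of_vanishing_axis hsnd one_pos two_pos le_rfl⟩
  · rw [hXs.fst.taylorCoeffAtZero_one_zero, hd.fst.fderiv]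
    exact left_ne_zero_of_mul hdet
  · rw [hXs.snd.taylorCoeffAtZero_zero_one, hd.snd.fderiv]
    exact right_ne_zero_of_mul hdet

end CoordinateChange

section Cube

variable {φ P : ℝ × ℝ → ℝ} {a b c d D : ℝ} {k n : ℕ}

/-- Coordinates that move both axes out of the line `x₂ = 0` turn `x₂ ^ 3` into a form containing
both `x₁ ^ 3` and `x₂ ^ 3`, so one of the axes may be assumed to be preserved. -/
theorem height_le_of_cube (hφ : SmoothNear φ 0)
    (hcube : HasInitialForm φ 1 1 3 fun x => d * x.2 ^ 3) (hd : d ≠ 0) (hD : 3 / 2 ≤ D)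
    (hP : HasInitialForm φ 1 2 k P)
    (H : ∀ (f : ℝ × ℝ → ℝ) (α s δ : ℝ), SmoothNear f 0 → α ≠ 0 → s ≠ 0 →
      taylorCoeffAtZero f (0, 3) ≠ 0 →
      HasInitialForm f 1 2 k (fun x => P (α * x.1, s * x.2 + δ * x.1 ^ 2)) →
      newtonDist f ≤ ENNReal.ofReal D) :
    height φ ≤ ENNReal.ofReal D := by
  have haxis {X} (hX : IsLocalCoordinateChange X) (hr : (fderiv ℝ X 0 (1, 0)).2 = 0) :
      newtonDist (φ ∘ X) ≤ ENNReal.ofReal D := by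
    obtain ⟨α, s, δ, hα, hs, h₁, h₂⟩ := hX.hasInitialForm_coords hr
    have hdet := hX.det_ne_zero
    rw [hr, mul_zero, sub_zero] at hdet
    refine H _ α s δ (hX.smoothNear_comp hφ) hα hs ?_ (hP.comp h₁ h₂)
    rw [(hcube.comp_fderiv hX.1 hX.2.1).taylorCoeffAtZero_eq_apply_zero_one (j := 3)
      (hX.smoothNear_comp hφ) one_pos one_pos]
    exact mul_ne_zero hd (pow_ne_zero 3 (right_ne_zero_of_mul hdet))
  refine iSup₂_le fun X hX => ?_
  have hsX := hX.smoothNear_comp hφ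
  have hcubeX := hcube.comp_fderiv hX.1 hX.2.1
  by_cases hr : (fderiv ℝ X 0 (1, 0)).2 = 0
  · exact haxis hX hr
  by_cases hs : (fderiv ℝ X 0 (0, 1)).2 = 0
  · rw [← hsX.newtonDist_swap]
    refine haxis hX.comp_swap ?_
    rw [hX.hasFDerivAt_comp_swap.fderiv]
    simpa using hs
  refine (newtonDist_le_three_halves (.inl ?_) (.inl ?_)).trans (ENNReal.ofReal_le_ofReal hD)
  · rw [hcubeX.taylorCoeffAtZero_eq_apply_one_zero (i := 3) hsX one_pos one_pos]
    exact mul_ne_zero hd (pow_ne_zero 3 hr)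
  · rw [hcubeX.taylorCoeffAtZero_eq_apply_zero_one (j := 3) hsX one_pos one_pos]
    exact mul_ne_zero hd (pow_ne_zero 3 hs)

theorem height_le_of_cube_of_pow (hφ : SmoothNear φ 0)
    (hcube : HasInitialForm φ 1 1 3 fun x => d * x.2 ^ 3) (hd : d ≠ 0) (hn : 3 ≤ n)
    (hc : c ≠ 0) (hform : HasInitialForm φ 1 2 n fun x => c * x.1 ^ n) :
    height φ ≤ ENNReal.ofReal ((3 * n : ℕ) / ((3 : ℕ) + n)) := by
  refine height_le_of_cube hφ hcube hd ?_ hform fun f α s δ hf hα _ h03 hfform => ?_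
  · have hn' : (3 : ℝ) ≤ n := by exact_mod_cast hn
    rw [div_le_div_iff₀ (by norm_num) (by positivity)]
    push_cast
    linarith
  have hn0 : taylorCoeffAtZero f (n, 0) = c * α ^ n := by
    rw [← one_mul n] at hfform
    simpa using hfform.taylorCoeffAtZero_eq_apply_one_zero hf one_pos two_pos
  exact newtonDist_le_of_weights (by omega) h03 (by omega) (by omega) (by omega)
    (i' := n) (by rw [hn0]; positivity) (by omega) (by omega) (by omega)

theorem height_le_of_cube_of_cubic_mul (hφ : SmoothNear φ 0)
    (hcube : HasInitialForm φ 1 1 3 fun x => d * x.2 ^ 3) (hd : d ≠ 0) (hb : b ≠ 0)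
    (hform : HasInitialForm φ 1 2 5 fun x => a * x.1 ^ 5 + b * x.1 ^ 3 * x.2) :
    height φ ≤ ENNReal.ofReal ((9 : ℕ) / ((2 : ℕ) + (3 : ℕ))) := by
  refine height_le_of_cube hφ hcube hd (by norm_num) hform fun f α s δ hf hα hs h03 hfform => ?_
  have h31 : taylorCoeffAtZero f (3, 1) = b * α ^ 3 * s := by
    rw [hfform.taylorCoeffAtZero_eq hf one_pos two_pos
      (Q := .C (a * α ^ 5 + b * α ^ 3 * δ) * .X ^ 5 + .C (b * α ^ 3 * s) * .X ^ 3)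
      (fun t => by simp; ring) (by norm_num)]
    rw [Polynomial.coeff_add, Polynomial.coeff_C_mul_X_pow, Polynomial.coeff_C_mul_X_pow]
    simp
  exact newtonDist_le_of_weights (by norm_num) h03 (by norm_num) (by norm_num) (by norm_num)
    (i' := 3) (j' := 1) (by rw [h31]; positivity) (by norm_num) (by norm_num) (by norm_num)

end Cube

section WeightedParts

variable {f : ℝ × ℝ → ℝ}

theorem SmoothNear.hasInitialForm_one_two_four (hf : SmoothNear f 0)
    (h : ∀ i j, 1 * i + 2 * j < 4 → taylorCoeffAtZero f (i, j) = 0) :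
    HasInitialForm f 1 2 4 fun x => taylorCoeffAtZero f (4, 0) * x.1 ^ 4 +
      taylorCoeffAtZero f (2, 1) * x.1 ^ 2 * x.2 + taylorCoeffAtZero f (0, 2) * x.2 ^ 2 := by
  refine (hf.hasInitialForm_weightedPart one_pos two_pos h).congr_right fun x => ?_
  simp [weightedPart, Finset.sum_filter, Finset.sum_product_right, Finset.sum_range_succ]
  ring

theorem SmoothNear.hasInitialForm_one_two_five (hf : SmoothNear f 0)
    (h : ∀ i j, 1 * i + 2 * j < 5 → taylorCoeffAtZero f (i, j) = 0) :
    HasInitialForm f 1 2 5 fun x => taylorCoeffAtZero f (5, 0) * x.1 ^ 5 +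
      taylorCoeffAtZero f (3, 1) * x.1 ^ 3 * x.2 + taylorCoeffAtZero f (1, 2) * x.1 * x.2 ^ 2 := by
  refine (hf.hasInitialForm_weightedPart one_pos two_pos h).congr_right fun x => ?_
  simp [weightedPart, Finset.sum_filter, Finset.sum_product_right, Finset.sum_range_succ]
  ring

theorem HasInitialForm.taylorCoeffAtZero_eq_zero_of_cube {d : ℝ} {i j : ℕ}
    (h : HasInitialForm f 1 1 3 fun x => d * x.2 ^ 3) (hf : SmoothNear f 0) (hj : j < 3)
    (hij : i + j = 3) : taylorCoeffAtZero f (i, j) = 0 := by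
  rw [h.taylorCoeffAtZero_eq hf one_pos one_pos (Q := .C d) (by simp) (by omega),
    Polynomial.coeff_C_of_ne_zero (by omega)]

end WeightedParts

/-- Smooth functions of height at most two, without Taylor terms of degree at most two, for which
no linear coordinate system is adapted, that is, attains the height. -/
structure IsExceptional (φ : ℝ × ℝ → ℝ) : Prop where
  smooth : SmoothNear φ 0
  jet_eq_zero : ∀ i j, i + j ≤ 2 → taylorCoeffAtZero φ (i, j) = 0
  height_le_two : height φ ≤ 2
  linHeight_lt : linHeight φ < height φ

namespace IsExceptional

variable {φ : ℝ × ℝ → ℝ}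

theorem hasInitialForm_cubic (h : IsExceptional φ) :
    HasInitialForm φ 1 1 3 fun x => taylorCoeffAtZero φ (3, 0) * x.1 ^ 3 +
      taylorCoeffAtZero φ (2, 1) * x.1 ^ 2 * x.2 + taylorCoeffAtZero φ (1, 2) * x.1 * x.2 ^ 2 +
      taylorCoeffAtZero φ (0, 3) * x.2 ^ 3 :=
  h.smooth.hasInitialForm_cubic h.jet_eq_zero

theorem comp_continuousLinearEquiv (h : IsExceptional φ) (L : (ℝ × ℝ) ≃L[ℝ] (ℝ × ℝ)) :
    IsExceptional (φ ∘ L) := by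
  have hL : SmoothNear (φ ∘ L) 0 :=
    (isLocalCoordinateChange_continuousLinearEquiv L).smoothNear_comp h.smooth
  refine ⟨hL, fun i j hij => ?_, ?_, ?_⟩
  · exact (h.hasInitialForm_cubic.comp_continuousLinearEquiv L).taylorCoeffAtZero_eq_zero hL one_pos
      one_pos (by omega)
  · rw [height_comp_continuousLinearEquiv]
    exact h.height_le_two
  · rw [height_comp_continuousLinearEquiv, linHeight_comp_continuousLinearEquiv]
    exact h.linHeight_lt

theorem false_of_weights (h : IsExceptional φ) {p q l : ℕ} (hpq : 0 < p + q)
    (hl : ∀ i j, 3 ≤ i + j → p * i + q * j < l → taylorCoeffAtZero φ (i, j) = 0)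
    (hle : height φ ≤ ENNReal.ofReal (l / (p + q))) : False := by
  refine (h.linHeight_lt.trans_le hle).not_ge ((le_newtonDist_of_weights hpq ?_).trans
    (newtonDist_le_linHeight φ))
  intro i j _ hlt
  by_cases hij : i + j ≤ 2
  · exact h.jet_eq_zero i j hij
  · exact hl i j (by omega) hlt

theorem false_of_weights_of_eq_two_mul (h : IsExceptional φ) {p q : ℕ} (hpq : 0 < p + q)
    (hl : ∀ i j, 3 ≤ i + j → p * i + q * j < 2 * (p + q) → taylorCoeffAtZero φ (i, j) = 0) :
    False := by
  refine h.false_of_weights hpq hl ?_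
  have hpq' : (0 : ℝ) < p + q := by exact_mod_cast hpq
  push_cast
  rw [mul_div_cancel_right₀ _ hpq'.ne', ENNReal.ofReal_ofNat]
  exact h.height_le_two

theorem not_hasInitialForm_pow_of_cube {n : ℕ} {c d : ℝ} (h : IsExceptional φ)
    (hcube : HasInitialForm φ 1 1 3 fun x => d * x.2 ^ 3) (hd : d ≠ 0) (hn : 4 ≤ n) (hn' : n ≤ 5)
    (hc : c ≠ 0) : ¬HasInitialForm φ 1 2 n fun x => c * x.1 ^ n := by
  intro hform
  refine h.false_of_weights (p := 3) (q := n) (l := 3 * n) (by omega) (fun i j hij hlt => ?_)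
    (height_le_of_cube_of_pow h.smooth hcube hd (by omega) hc hform)
  have hj : j < 3 := by
    by_contra! hj
    nlinarith
  rcases hij.eq_or_lt with hij | hij
  · exact hcube.taylorCoeffAtZero_eq_zero_of_cube h.smooth hj hij.symm
  have hle : 1 * i + 2 * j ≤ n ∧ i ≠ n := by
    interval_cases n <;> omega
  rcases hle.1.lt_or_eq with hlt | heq
  · exact hform.taylorCoeffAtZero_eq_zero h.smooth one_pos two_pos hlt
  · rw [hform.taylorCoeffAtZero_eq h.smooth one_pos two_pos (Q := .C c * .X ^ n) (by simp) heq,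
      Polynomial.coeff_C_mul_X_pow, if_neg hle.2]

theorem not_hasInitialForm_cubic_mul_of_cube {a b d : ℝ} (h : IsExceptional φ)
    (hcube : HasInitialForm φ 1 1 3 fun x => d * x.2 ^ 3) (hd : d ≠ 0) (hb : b ≠ 0) :
    ¬HasInitialForm φ 1 2 5 fun x => a * x.1 ^ 5 + b * x.1 ^ 3 * x.2 := by
  intro hform
  refine h.false_of_weights (p := 2) (q := 3) (l := 9) (by norm_num) (fun i j hij hlt => ?_)
    (height_le_of_cube_of_cubic_mul h.smooth hcube hd hb hform)
  rcases hij.eq_or_lt with hij | hij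
  · exact hcube.taylorCoeffAtZero_eq_zero_of_cube h.smooth (by omega) hij.symm
  · exact hform.taylorCoeffAtZero_eq_zero h.smooth one_pos two_pos (by omega)

theorem not_hasInitialForm_cube {d : ℝ} (h : IsExceptional φ) (hd : d ≠ 0) :
    ¬HasInitialForm φ 1 1 3 fun x => d * x.2 ^ 3 := by
  intro hcube
  have hcubic {i j : ℕ} (hj : j < 3) (hij : i + j = 3) : taylorCoeffAtZero φ (i, j) = 0 :=
    hcube.taylorCoeffAtZero_eq_zero_of_cube h.smooth hj hij
  have hform₄ := h.smooth.hasInitialForm_one_two_four fun i j hlt => by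
    by_cases hij : i + j ≤ 2
    exacts [h.jet_eq_zero i j hij, hcubic (by omega) (by omega)]
  simp only [hcubic (show 1 < 3 by norm_num), h.jet_eq_zero 0 2 le_rfl, zero_mul, add_zero]
    at hform₄
  have h40 : taylorCoeffAtZero φ (4, 0) = 0 := by
    by_contra h40
    exact h.not_hasInitialForm_pow_of_cube hcube hd (by norm_num) (by norm_num) h40 hform₄
  have hform₅ := h.smooth.hasInitialForm_one_two_five fun i j hlt => by
    rcases (by omega : i + j ≤ 2 ∨ i + j = 3 ∧ j < 3 ∨ i = 4 ∧ j = 0) with hij | hij | ⟨rfl, rfl⟩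
    exacts [h.jet_eq_zero i j hij, hcubic hij.2 hij.1, h40]
  simp only [hcubic (show 2 < 3 by norm_num), zero_mul, add_zero] at hform₅
  have h31 : taylorCoeffAtZero φ (3, 1) = 0 := by
    by_contra h31
    exact h.not_hasInitialForm_cubic_mul_of_cube hcube hd h31 hform₅
  simp only [h31, zero_mul, add_zero] at hform₅
  have h50 : taylorCoeffAtZero φ (5, 0) = 0 := by
    by_contra h50
    exact h.not_hasInitialForm_pow_of_cube hcube hd (by norm_num) le_rfl h50 hform₅
  refine h.false_of_weights_of_eq_two_mul (p := 1) (q := 2) (by norm_num) fun i j hij hlt => ?_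
  rcases (by omega : i + j = 3 ∧ j < 3 ∨ i = 4 ∧ j = 0 ∨ i = 3 ∧ j = 1 ∨ i = 5 ∧ j = 0) with
    hij | ⟨rfl, rfl⟩ | ⟨rfl, rfl⟩ | ⟨rfl, rfl⟩
  exacts [hcubic hij.2 hij.1, h40, h31, h50]

theorem exists_cubic_coeff_ne_zero (h : IsExceptional φ) :
    ∃ i j, i + j = 3 ∧ taylorCoeffAtZero φ (i, j) ≠ 0 := by
  by_contra! h3
  exact h.false_of_weights_of_eq_two_mul (p := 1) (q := 1) (by norm_num) fun i j hij hlt =>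
    h3 i j (by omega)

end IsExceptional

/-- The linear coordinate change `(x₁, x₂) ↦ (x₁ + c x₂, x₂)`. -/
noncomputable def horizontalShear (c : ℝ) : (ℝ × ℝ) ≃L[ℝ] (ℝ × ℝ) :=
  .equivOfInverse
    ((ContinuousLinearMap.fst ℝ ℝ ℝ + c • ContinuousLinearMap.snd ℝ ℝ ℝ).prod
      (ContinuousLinearMap.snd ℝ ℝ ℝ))
    ((ContinuousLinearMap.fst ℝ ℝ ℝ - c • ContinuousLinearMap.snd ℝ ℝ ℝ).prod
      (ContinuousLinearMap.snd ℝ ℝ ℝ))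
    (fun x => by simp) (fun x => by simp)

theorem horizontalShear_apply (c : ℝ) (x : ℝ × ℝ) :
    horizontalShear c x = (x.1 + c * x.2, x.2) :=
  rfl

theorem HasNormalForm.of_comp_continuousLinearEquiv {φ : ℝ × ℝ → ℝ} {m : ℕ} {n : ℕ∞}
    {L : (ℝ × ℝ) ≃L[ℝ] (ℝ × ℝ)} (h : HasNormalForm (φ ∘ L) m n) : HasNormalForm φ m n := by
  obtain ⟨L', hL'⟩ := h
  exact ⟨L'.trans L, hL'⟩

theorem IsPrenormalForm.hasNormalForm {F b : ℝ × ℝ → ℝ} {ψ w b₀ : ℝ → ℝ} {m : ℕ} {n : ℕ∞}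
    (h : IsPrenormalForm F b ψ b₀) (hm : 2 ≤ m) (hw : SmoothNear w 0) (hw0 : w 0 ≠ 0)
    (hψ : ψ =ᶠ[𝓝 0] fun t => t ^ m * w t) (hmn : ((2 * m + 1 : ℕ) : ℕ∞) < n)
    (hb₀ : HasVanishingOrder b₀ n) : HasNormalForm F m n := by
  refine ⟨.refl ℝ _, b, w, b₀, h.smooth_b, hw, h.smooth_b₀, ?_, h.b_zero,
    taylorCoeffAtZero_eq_zero_iff.not.1 h.b_one_zero,
    taylorCoeffAtZero_eq_zero_iff.1 h.b_zero_one, hm, hw0, hmn, hb₀⟩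
  filter_upwards [h.eventuallyEq, (continuous_fst.tendsto (0 : ℝ × ℝ)).eventually hψ] with x hx hψx
  rw [← hψx]
  exact hx

namespace IsExceptional

variable {φ : ℝ × ℝ → ℝ}

theorem three_halves_le_linHeight (h : IsExceptional φ) :
    ENNReal.ofReal (3 / 2) ≤ linHeight φ := by
  have hle := (le_newtonDist_of_weights (f := φ) (p := 1) (q := 1) (l := 3) (by norm_num)
    fun i j _ hlt => h.jet_eq_zero i j (by omega)).trans (newtonDist_le_linHeight φ)
  norm_num at hle
  exact hle

theorem exists_double_root (h : IsExceptional φ) : ∃ L : (ℝ × ℝ) ≃L[ℝ] (ℝ × ℝ),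
    taylorCoeffAtZero (φ ∘ L) (3, 0) = 0 ∧ taylorCoeffAtZero (φ ∘ L) (2, 1) = 0 := by
  obtain ⟨X, hX, hlt⟩ : ∃ X, IsLocalCoordinateChange X ∧ linHeight φ < newtonDist (φ ∘ X) := by
    simpa [height, lt_iSup_iff] using h.linHeight_lt
  have hXs := hX.smoothNear_comp h.smooth
  have hcubicX := h.hasInitialForm_cubic.comp_fderiv hX.1 hX.2.1
  obtain ⟨-, -, A, hA⟩ := hX
  have hAs := (h.comp_continuousLinearEquiv A).smooth
  have hcubicA := h.hasInitialForm_cubic.comp_continuousLinearEquiv A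
  rw [← hA] at hcubicX
  have hXA {i j : ℕ} (hij : 1 * i + 1 * j = 3) :
      taylorCoeffAtZero (φ ∘ X) (i, j) = taylorCoeffAtZero (φ ∘ A) (i, j) :=
    hcubicX.taylorCoeffAtZero_congr hcubicA hXs hAs one_pos one_pos hij
  have hroot : (taylorCoeffAtZero (φ ∘ A) (3, 0) = 0 ∧ taylorCoeffAtZero (φ ∘ A) (2, 1) = 0) ∨
      (taylorCoeffAtZero (φ ∘ A) (0, 3) = 0 ∧ taylorCoeffAtZero (φ ∘ A) (1, 2) = 0) := by
    rw [← hXA (by norm_num), ← hXA (by norm_num), ← hXA (by norm_num), ← hXA (by norm_num)]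
    by_contra! hne
    refine (h.three_halves_le_linHeight.trans_lt hlt).not_ge (newtonDist_le_three_halves ?_ ?_)
    · exact or_iff_not_imp_left.2 fun h30 => hne.1 (not_not.1 h30)
    · exact or_iff_not_imp_left.2 fun h03 => hne.2 (not_not.1 h03)
  rcases hroot with hroot | ⟨h03, h12⟩
  · exact ⟨A, hroot⟩
  · refine ⟨(ContinuousLinearEquiv.prodComm ℝ ℝ ℝ).trans A, ?_, ?_⟩
    · exact (hAs.taylorCoeffAtZero_swap 3 0).trans h03
    · exact (hAs.taylorCoeffAtZero_swap 2 1).trans h12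

theorem exists_hasInitialForm_mul_sq (h : IsExceptional φ) :
    ∃ (L : (ℝ × ℝ) ≃L[ℝ] (ℝ × ℝ)) (c : ℝ), c ≠ 0 ∧
      HasInitialForm (φ ∘ L) 1 1 3 fun x => c * x.1 * x.2 ^ 2 := by
  obtain ⟨L, h30, h21⟩ := h.exists_double_root
  have hL := h.comp_continuousLinearEquiv L
  have hcubic := hL.hasInitialForm_cubic
  simp only [h30, h21, zero_mul, zero_add] at hcubic
  set c := taylorCoeffAtZero (φ ∘ L) (1, 2)
  set d := taylorCoeffAtZero (φ ∘ L) (0, 3)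
  have hc : c ≠ 0 := by
    intro hc
    simp only [hc, zero_mul, zero_add] at hcubic
    by_cases hd : d = 0
    · obtain ⟨i, j, hij, hne⟩ := hL.exists_cubic_coeff_ne_zero
      refine hne ?_
      rw [hcubic.taylorCoeffAtZero_eq hL.smooth one_pos one_pos (Q := 0) (by simp [hd]) (by omega),
        Polynomial.coeff_zero]
    · exact hL.not_hasInitialForm_cube hd hcubic
  refine ⟨(horizontalShear (-d / c)).trans L, c, hc,
    (hcubic.comp_continuousLinearEquiv (horizontalShear (-d / c))).congr_right fun x => ?_⟩
  simp only [Function.comp_apply, horizontalShear_apply]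
  field_simp
  ring

theorem not_le_of_isPrenormalForm {b : ℝ × ℝ → ℝ} {ψ b₀ : ℝ → ℝ} {m n : ℕ∞}
    (h : IsExceptional φ) (hφ : IsPrenormalForm φ b ψ b₀) (hψ : HasVanishingOrder ψ m)
    (hb₀ : HasVanishingOrder b₀ n) (hn : 4 ≤ n) : ¬n ≤ 2 * m + 1 := by
  intro hle
  have hlin (l : ℕ) (hl : 4 ≤ l) (hln : (l : ℕ∞) ≤ n) :
      ENNReal.ofReal (2 * l / (l + 1)) ≤ linHeight φ := by
    obtain ⟨β, hβ, hb₀β⟩ := hb₀.exists_eq_pow_mul hφ.smooth_b₀ hln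
    have hlm : ((l / 2 : ℕ) : ℕ∞) ≤ m := by
      cases m with
      | top => exact le_top
      | coe m =>
        have : (l : ℕ∞) ≤ (2 * m + 1 : ℕ) := by exact_mod_cast hln.trans hle
        norm_cast at this ⊢
        omega
    obtain ⟨w, hw, hψw⟩ := hψ.exists_eq_pow_mul hφ.smooth_ψ hlm
    exact hφ.le_linHeight hl (by omega) hw hψw hβ hb₀β
  refine h.linHeight_lt.not_ge ?_
  rcases hb₀ with ⟨k, rfl, β, hβ, hβ0, hb₀β⟩ | ⟨rfl, -⟩
  · have hk : 4 ≤ k := by exact_mod_cast hn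
    exact (hφ.height_le hk hβ hβ0 hb₀β).trans (hlin k hk le_rfl)
  · exact h.height_le_two.trans (two_le_of_forall_two_mul_div_le fun l hl => hlin l hl le_top)

theorem exists_hasNormalForm_of_hasInitialForm {c : ℝ} (h : IsExceptional φ) (hc : c ≠ 0)
    (hform : HasInitialForm φ 1 1 3 fun x => c * x.1 * x.2 ^ 2) :
    ∃ (m : ℕ) (n : ℕ∞), HasNormalForm φ m n := by
  obtain ⟨F, hF, hφF⟩ := h.smooth.exists_contDiff
  obtain ⟨b, ζ, β, hζ, hβ, hprenormal⟩ :=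
    (hform.congr one_pos one_pos hφF.symm).exists_isPrenormalForm hF hc
  have hφ : IsPrenormalForm φ b (fun t => t ^ 2 * ζ t) fun t => t ^ 4 * β t :=
    { hprenormal with eventuallyEq := hφF.trans hprenormal.eventuallyEq }
  obtain ⟨m, hm⟩ := hφ.smooth_ψ.exists_hasVanishingOrder
  obtain ⟨n, hn⟩ := hφ.smooth_b₀.exists_hasVanishingOrder
  have hm2 := hm.le_of_eventuallyEq_pow_mul (.of_contDiff hζ 0) .rfl
  have hn4 := hn.le_of_eventuallyEq_pow_mul (.of_contDiff hβ 0) .rfl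
  have hmn := not_le.1 (h.not_le_of_isPrenormalForm hφ hm hn hn4)
  rcases hm with ⟨m, rfl, w, hw, hw0, hψ⟩ | ⟨rfl, -⟩
  · exact ⟨m, n, hφ.hasNormalForm (by exact_mod_cast hm2) hw hw0 hψ (by exact_mod_cast hmn) hn⟩
  · simp at hmn

theorem exists_hasNormalForm (h : IsExceptional φ) :
    ∃ (m : ℕ) (n : ℕ∞), HasNormalForm φ m n := by
  obtain ⟨L, c, hc, hform⟩ := h.exists_hasInitialForm_mul_sq
  obtain ⟨m, n, hmn⟩ :=
    (h.comp_continuousLinearEquiv L).exists_hasNormalForm_of_hasInitialForm hc hform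
  exact ⟨m, n, hmn.of_comp_continuousLinearEquiv⟩

end IsExceptional

theorem mainTheorem8 (φ : ℝ × ℝ → ℝ) (hφ : SmoothNear φ 0) :
    ((∀ i j : ℕ, i + j ≤ 2 → partialAtZero i j φ = 0) → height φ ≤ 2 →
        linHeight φ < height φ →
      (∃ (m : ℕ) (n : ℕ∞), HasNormalForm φ m n) ∧
      (∀ (m : ℕ) (n : ℕ∞), HasNormalForm φ m n →
        (∀ k : ℕ, n = (k : ℕ∞) → height φ = 2 * (k : ℝ≥0∞) / ((k : ℝ≥0∞) + 1)) ∧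
        (n = ⊤ → height φ = 2) ∧
        linHeight φ = (2 * (m : ℝ≥0∞) + 1) / ((m : ℝ≥0∞) + 1))) ∧
    (∀ (m : ℕ) (n : ℕ∞), HasNormalForm φ m n →
      (∀ i j : ℕ, i + j ≤ 2 → partialAtZero i j φ = 0) ∧ height φ ≤ 2 ∧
        linHeight φ < height φ) := by
  refine ⟨fun h₂ hle hlt => ⟨IsExceptional.exists_hasNormalForm
    ⟨hφ, fun i j hij => taylorCoeffAtZero_eq_zero_iff.2 (h₂ i j hij), hle, hlt⟩,
    fun m n h => ⟨?_, ?_, ?_⟩⟩,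
    fun m n h => ⟨fun i j => h.partialAtZero_eq_zero, h.height_le_two_and_linHeight_lt⟩⟩
  · rintro k rfl
    rw [h.height_eq_natCast, ofReal_two_mul_div]
  · rintro rfl
    exact h.height_eq_two
  · rw [h.linHeight_eq, ofReal_two_mul_div_odd]
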